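/- All digraphs are reflexive. For $n\ge 3$, an $n$-cycle is a reflexive digraph on $\{0,\dots,n-1\}$ in which, for each $i$ (modulo $n$), one or both of the arcs $(i,i+1)$, $(i+1,i)$ are present, and there are no other arcs between distinct vertices. A path of length $k$ is a reflexive digraph on $\{0,\dots,k\}$ in which, for each $0\le i<k$, one or both of the arcs $(i,i+1)$, $(i+1,i)$ are present, and there are no other arcs between distinct vertices. The product $\prod_i\mathbb{Q}_i$ of digraphs has as vertices the tuples $(x_i)_i$ with $x_i$ a vertex of $\mathbb{Q}_i$, and $(x,y)$ is an arc if and only if $(x_i,y_i)$ is an arc of $\mathbb{Q}_i$ for every $i$. An $n$-cycle $\mathbb{G}$ *satisfies the path condition* if there do not exist finitely many paths $\mathbb{Q}_1,\dots,\mathbb{Q}_m$ of length $n-2$, each isomorphic to an induced subdigraph of $\mathbb{G}$, together with a surjective homomorphism $\prod_i\mathbb{Q}_i\to\mathbb{G}$; otherwise it *fails* the path condition. For a word $W=x_1\cdots x_k$ ($k\ge 3$) on the alphabet $\{+,-,*\}$, let $C(W)$ be the $k$-cycle in which the arcs between $i-1$ and $i$ (modulo $k$) are $(i-1,i)$ only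 if $x_i=+$, $(i,i-1)$ only if $x_i=-$, and both if $x_i=*$; write $\mathbb{G}=C(W)$ if $\mathbb{G}$ is isomorphic to $C(W)$. **Theorem.** Let $n\ge 4$ and let $\mathbb{G}$ be an $n$-cycle that fails the path condition. Then there exist (possibly empty) words $A$ and $B$ on $\{+,-,*\}$ such that $$\mathbb{G}=C(A{*}{*}B{+})=C(A{+}B{*}{*})=C(A{-}B{*}{*}).$$ -/

import Mathlib

namespace ReflexiveCycles

/-- The alphabet `{+, -, *}`. -/
inductive Letter where
  | plus
  | minus
  | star
  deriving DecidableEq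

/-- A word on `{+, -, *}`; concatenation is `++`. -/
abbrev Word := List Letter

/-- A path of length `k`: a reflexive digraph on `{0, …, k}` in which two distinct vertices are
joined by one or both of the two possible arcs exactly when they are consecutive. -/
structure IsPath (k : ℕ) (P : Digraph (Fin (k + 1))) : Prop where
  refl : ∀ i, P.Adj i i
  adj_iff : ∀ i j : Fin (k + 1), i ≠ j →
    ((P.Adj i j ∨ P.Adj j i) ↔ ((i : ℕ) + 1 = j ∨ (j : ℕ) + 1 = i))

/-- An `n`-cycle, `n ≥ 3`: a reflexive digraph on `{0, …, n - 1}` in which two distinct vertices are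
joined by one or both of the two possible arcs exactly when they are consecutive modulo `n`. -/
structure IsCycle (n : ℕ) (G : Digraph (Fin n)) : Prop where
  three_le : 3 ≤ n
  refl : ∀ i, G.Adj i i
  adj_iff : ∀ i j : Fin n, i ≠ j →
    ((G.Adj i j ∨ G.Adj j i) ↔ (((i : ℕ) + 1) % n = j ∨ ((j : ℕ) + 1) % n = i))

/-- The reflexive digraph `C(W)` on `{0, …, |W| - 1}`: the letter of `W` in position `i`
(counting from `0`) describes the arcs between `i` and `i + 1` modulo `|W|`; it is `+` for the arc
`i → i + 1` alone, `-` for the arc `i + 1 → i` alone, and `*` for both arcs. -/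
def cycleOfWord (W : Word) : Digraph (Fin W.length) where
  Adj i j := i = j
    ∨ (((i : ℕ) + 1) % W.length = j ∧ (W.get i = Letter.plus ∨ W.get i = Letter.star))
    ∨ (((j : ℕ) + 1) % W.length = i ∧ (W.get j = Letter.minus ∨ W.get j = Letter.star))

/-- The digraph `G` is, up to isomorphism, the cycle `C(W)`. -/
def IsCycleOf {V : Type*} (G : Digraph V) (W : Word) : Prop :=
  Nonempty (G.Adj ≃r (cycleOfWord W).Adj)

/-- The product of a family of digraphs. -/
def prodDigraph {ι : Type*} {V : ι → Type*} (Q : (i : ι) → Digraph (V i)) :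
    Digraph ((i : ι) → V i) where
  Adj x y := ∀ i, (Q i).Adj (x i) (y i)

/-- The path condition for a digraph `G` on `n` vertices (used for `n`-cycles): there is no
homomorphism onto `G` from a product of finitely many paths of length `n - 2`, each of which is
isomorphic to an induced subdigraph of `G`. -/
def PathCondition (n : ℕ) (G : Digraph (Fin n)) : Prop :=
  ¬ ∃ (m : ℕ) (Q : Fin m → Digraph (Fin (n - 2 + 1))),
      (∀ i, IsPath (n - 2) (Q i)) ∧
      (∀ i, Nonempty ((Q i).Adj ↪r G.Adj)) ∧
      ∃ f : (prodDigraph Q).Adj →r G.Adj, Function.Surjective f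

end ReflexiveCycles

/-!
If the path condition fails, there is a surjection `f` from a product of paths onto `G`. The product
is contractible and `G` behaves like a circle since `n ≥ 4`, so `f` lifts to an integer-valued `F`.
By surjectivity, the values of `F` at some vertices `u` and `v` differ by at least `n - 1`. A walk
in the product from `u` to `v` thus crosses the word `r` formed by the letters between `n`
consecutive vertices of `G`. Such a walk exists for every pattern of directions that is rich enough
to cross all subwords `q` of length `n - 2` of the cyclic word `r x` of `G`: every such pattern
crosses `r`.

Orient each `*` of `r`, and consider a rich pattern that crosses `r` only with its last direction.
Without this direction it does not cross some `q`. Counting one-way letters shows that `x` is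
one-way, that `q` is followed by `**` in the cyclic word, and that, up to the places of some `*`,
`q` arises from `r` by replacing `**` by a one-way letter directed against the first of these `*`.
If no `**` admitted both replacements, one could orient the letters `*` so that none is possible.
Hence some `**` in `r = A ** B` admits both, and `r x`, `A + B **` and `A - B **` are readings of
the same cyclic word.
-/

namespace ReflexiveCycles

namespace Letter

/-- The letter with a single arc: `+` for `true`, `-` for `false`. -/
def oneWay : Bool → Letter
  | true => plus
  | false => minus

/-- The letter describing the same arcs read from the other end. -/
def flip : Letter → Letter
  | plus => minus
  | minus => plus
  | star => star

/-- The letter `c` has an arc in the direction `y`, where `true` is forward. -/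
def Allows (c : Letter) (y : Bool) : Prop := c = star ∨ c = oneWay y

theorem oneWay_injective : Function.Injective oneWay := by decide

@[simp] theorem oneWay_inj {a b : Bool} : oneWay a = oneWay b ↔ a = b := oneWay_injective.eq_iff

@[simp] theorem oneWay_ne_star (a : Bool) : oneWay a ≠ star := by cases a <;> decide

theorem eq_star_or_oneWay (c : Letter) : c = star ∨ ∃ a, c = oneWay a := by
  cases c
  exacts [.inr ⟨true, rfl⟩, .inr ⟨false, rfl⟩, .inl rfl]

@[simp] theorem flip_star : flip star = star := rfl

@[simp] theorem flip_oneWay (a : Bool) : (oneWay a).flip = oneWay (!a) := by cases a <;> rfl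

@[simp] theorem flip_flip (c : Letter) : c.flip.flip = c := by cases c <;> rfl

@[simp] theorem allows_star (y : Bool) : Allows star y := .inl rfl

@[simp] theorem allows_oneWay {a y : Bool} : (oneWay a).Allows y ↔ a = y := by simp [Allows]

theorem not_allows_iff {c : Letter} {y : Bool} : ¬ c.Allows y ↔ c = oneWay (!y) := by
  rcases c.eq_star_or_oneWay with rfl | ⟨a, rfl⟩
  · simpa using (oneWay_ne_star (!y)).symm
  · cases a <;> cases y <;> simp

end Letter

open Letter List

section NumOneWay

/-- The number of letters `+` and `-` of a word. -/
def numOneWay (q : Word) : ℕ := q.countP (· ≠ star)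

@[simp] theorem numOneWay_nil : numOneWay [] = 0 := rfl

@[simp] theorem numOneWay_star_cons (q : Word) : numOneWay (star :: q) = numOneWay q := by
  simp [numOneWay]

@[simp] theorem numOneWay_oneWay_cons (a : Bool) (q : Word) :
    numOneWay (oneWay a :: q) = numOneWay q + 1 := by
  simp [numOneWay]

@[simp] theorem numOneWay_append (p q : Word) :
    numOneWay (p ++ q) = numOneWay p + numOneWay q := by
  simp [numOneWay]

@[simp] theorem numOneWay_replicate_star (k : ℕ) : numOneWay (replicate k star) = 0 := by
  simp [numOneWay, countP_replicate]

theorem numOneWay_le_of_sublist {p q : Word} (h : p <+ q) : numOneWay p ≤ numOneWay q :=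
  h.countP_le

end NumOneWay

/-! ### Crossing a word by a pattern of directions -/

section Embeds

/-- The word `q` embeds into the pattern `w` of directions: some walk that traverses a path with
arcs `q` from end to end can be timed by `w`. -/
abbrev Embeds (q : Word) (w : List Bool) : Prop := SublistForall₂ Allows q w

theorem Embeds.of_append {p q : Word} {w : List Bool} (h : Embeds (p ++ q) w) : Embeds p w := by
  obtain ⟨l, hl, hlw⟩ := sublistForall₂_iff.1 h
  exact sublistForall₂_iff.2 ⟨l.take p.length, (forall₂_take_append _ _ _ hl.flip).flip,
    (take_sublist _ _).trans hlw⟩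

theorem embeds_cons_iff_of_allows {c : Letter} {q : Word} {y : Bool} {w : List Bool}
    (hc : c.Allows y) : Embeds (c :: q) (y :: w) ↔ Embeds q w := by
  refine ⟨fun h ↦ ?_, .cons hc⟩
  obtain ⟨l, hl, hlw⟩ := sublistForall₂_iff.1 h
  obtain ⟨z, l, -, hl', rfl⟩ := forall₂_cons_left_iff.1 hl
  exact sublistForall₂_iff.2 ⟨l, hl', hlw.of_cons_cons⟩

theorem embeds_cons_iff_of_not_allows {c : Letter} {q : Word} {y : Bool} {w : List Bool}
    (hc : ¬ c.Allows y) : Embeds (c :: q) (y :: w) ↔ Embeds (c :: q) w := by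
  refine ⟨fun h ↦ ?_, .cons_right⟩
  cases h with
  | cons h _ => exact absurd h hc
  | cons_right h => exact h

theorem embeds_dropLast_iff {q : Word} {w : List Bool} (hw : w ≠ []) :
    Embeds q w.dropLast ↔ Embeds (q ++ [star]) w := by
  simp only [Embeds, sublistForall₂_iff]
  constructor
  · rintro ⟨l, hl, hlw⟩
    refine ⟨l ++ [w.getLast hw], rel_append hl (by simp), ?_⟩
    simpa [dropLast_append_getLast] using hlw.append_right [w.getLast hw]
  · rintro ⟨l, hl, hlw⟩
    refine ⟨l.take q.length, (forall₂_take_append _ _ _ hl.flip).flip, ?_⟩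
    have hlen : l.dropLast = l.take q.length := by
      rw [dropLast_eq_take, ← hl.length_eq]; simp
    simpa only [tail_reverse, reverse_sublist, hlen] using hlw.reverse.tail

end Embeds

/-- A letter together with a choice of direction when it is `*`. -/
inductive OrientedLetter where
  | oneWay (a : Bool)
  | twoWay (s : Bool)

namespace OrientedLetter

/-- The underlying letter. -/
def letter : OrientedLetter → Letter
  | oneWay a => Letter.oneWay a
  | twoWay _ => star

@[simp] theorem letter_oneWay (a : Bool) : (oneWay a).letter = Letter.oneWay a := rfl

@[simp] theorem letter_twoWay (s : Bool) : (twoWay s).letter = star := rfl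

/-- A `*` just before a one-way letter is directed like that letter. -/
def Agrees : OrientedLetter → OrientedLetter → Prop
  | twoWay s, oneWay a => s = a
  | _, _ => True

/-- Directions in which the walk of a pattern is delayed `N` times by, and then crosses, the letter
`t`. -/
def block (N : ℕ) : OrientedLetter → List Bool
  | oneWay a => replicate N (!a) ++ [a]
  | twoWay s => [s]

end OrientedLetter

open OrientedLetter (twoWay)

/-- The word underlying a list of oriented letters. -/
def letters (ts : List OrientedLetter) : Word := ts.map OrientedLetter.letter

@[simp] theorem letters_nil : letters [] = [] := rfl

@[simp] theorem letters_cons (t : OrientedLetter) (ts : List OrientedLetter) :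
    letters (t :: ts) = t.letter :: letters ts := rfl

@[simp] theorem letters_append (p q : List OrientedLetter) :
    letters (p ++ q) = letters p ++ letters q := map_append

@[simp] theorem length_letters (ts : List OrientedLetter) : (letters ts).length = ts.length :=
  length_map _

@[simp] theorem letters_map_twoWay (l : List Bool) :
    letters (l.map twoWay) = replicate l.length star := by
  simp [letters, Function.comp_def]

/-- Its last direction is the first one at which `ts` has been crossed; among the patterns with
this property it is, up to the choice of directions in `ts` and for large `N`, a richest one. -/
def crossingPattern (N : ℕ) (ts : List OrientedLetter) : List Bool :=
  ts.flatMap (OrientedLetter.block N)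

@[simp] theorem crossingPattern_oneWay_cons (N : ℕ) (a : Bool) (ts : List OrientedLetter) :
    crossingPattern N (.oneWay a :: ts) = replicate N (!a) ++ a :: crossingPattern N ts := by
  simp [crossingPattern, OrientedLetter.block]

@[simp] theorem crossingPattern_twoWay_cons (N : ℕ) (s : Bool) (ts : List OrientedLetter) :
    crossingPattern N (.twoWay s :: ts) = s :: crossingPattern N ts := rfl

theorem embeds_oneWay_cons_replicate_append {a : Bool} {q : Word} {w : List Bool} (N : ℕ) :
    Embeds (oneWay a :: q) (replicate N (!a) ++ w) ↔ Embeds (oneWay a :: q) w := by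
  induction N with
  | zero => rfl
  | succ N ih =>
    rw [replicate_succ, cons_append, embeds_cons_iff_of_not_allows (by simp), ih]

theorem not_embeds_crossingPattern (N : ℕ) :
    ∀ ts, ¬ Embeds (letters ts ++ [star]) (crossingPattern N ts)
  | [] => nofun
  | .oneWay a :: ts => by
    rw [letters_cons, crossingPattern_oneWay_cons, OrientedLetter.letter_oneWay, cons_append,
      embeds_oneWay_cons_replicate_append, embeds_cons_iff_of_allows (by simp)]
    exact not_embeds_crossingPattern N ts
  | .twoWay s :: ts => by
    rw [letters_cons, crossingPattern_twoWay_cons, OrientedLetter.letter_twoWay, cons_append,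
      embeds_cons_iff_of_allows (by simp)]
    exact not_embeds_crossingPattern N ts

/-- The greedy crossing of the word by the pattern `crossingPattern N ts`, for large `N`, is not
completed before the last direction of the pattern. The constructors are the steps of the greedy
crossing. -/
inductive Overruns : List OrientedLetter → Word → Prop
  | nil (q : Word) : Overruns [] q
  | hit {a : Bool} {ts : List OrientedLetter} {q : Word} (h : Overruns ts q) :
      Overruns (.oneWay a :: ts) (oneWay a :: q)
  | stay {a : Bool} {c : Letter} {ts : List OrientedLetter} {q : Word} (hc : c ≠ oneWay a)
      (h : Overruns (.oneWay a :: ts) q) : Overruns (.oneWay a :: ts) (c :: q)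
  | take {s : Bool} {c : Letter} {ts : List OrientedLetter} {q : Word} (hc : c.Allows s)
      (h : Overruns ts q) : Overruns (.twoWay s :: ts) (c :: q)
  | skip {s : Bool} {c : Letter} {ts : List OrientedLetter} {q : Word} (hc : ¬ c.Allows s)
      (h : Overruns ts (c :: q)) : Overruns (.twoWay s :: ts) (c :: q)

/-- In a list of oriented letters with this property, the last `*` of each run is directed like the
letter that follows it. -/
abbrev IsCoherent (ts : List OrientedLetter) : Prop := IsChain OrientedLetter.Agrees ts

namespace Overruns

theorem of_not_embeds {N : ℕ} : ∀ {ts : List OrientedLetter} {q : Word}, q.length ≤ N →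
    ¬ Embeds (q ++ [star]) (crossingPattern N ts) → Overruns ts q
  | [], q, _, _ => .nil q
  | .oneWay a :: ts, q, hq, h => by
    suffices ∀ (q : Word) (M : ℕ), q.length ≤ M → q.length ≤ N →
        ¬ Embeds (q ++ [star]) (replicate M (!a) ++ a :: crossingPattern N ts) →
        Overruns (.oneWay a :: ts) q from this q N hq hq (by simpa using h)
    intro q
    induction q with
    | nil =>
      rintro (_ | M) - - h <;>
        exact absurd ((embeds_cons_iff_of_allows (allows_star _)).2 .nil) h
    | cons c q ih =>
      intro M hM hN h
      rw [length_cons] at hM hN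
      by_cases hc : c = oneWay a
      · subst hc
        rw [cons_append, embeds_oneWay_cons_replicate_append,
          embeds_cons_iff_of_allows (by simp)] at h
        exact .hit (of_not_embeds (N := N) (by omega) h)
      · obtain ⟨M, rfl⟩ := Nat.exists_eq_add_of_lt hM
        have hca : c.Allows (!a) := by
          by_contra hca
          exact hc (by simpa using not_allows_iff.1 hca)
        refine .stay hc (ih (q.length + M) (by omega) (by omega) ?_)
        rwa [replicate_succ, cons_append, cons_append, embeds_cons_iff_of_allows hca] at h
  | .twoWay s :: ts, [], _, h => absurd ((embeds_cons_iff_of_allows (allows_star s)).2 .nil) h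
  | .twoWay s :: ts, c :: q, hq, h => by
    rw [length_cons] at hq
    by_cases hc : c.Allows s
    · refine .take hc (of_not_embeds (N := N) (by omega) ?_)
      rwa [← embeds_cons_iff_of_allows hc]
    · refine .skip hc (of_not_embeds hq ?_)
      rwa [cons_append, ← embeds_cons_iff_of_not_allows hc]

section Crossing

variable {ts : List OrientedLetter} {q : Word}

theorem numOneWay_letters_le (h : Overruns ts q) : numOneWay (letters ts) ≤ numOneWay q := by
  induction h with
  | nil => simp
  | hit _ ih => simpa using ih
  | stay _ _ ih => exact ih.trans (numOneWay_le_of_sublist (sublist_cons_self _ _))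
  | take _ _ ih => simpa using ih.trans (numOneWay_le_of_sublist (sublist_cons_self _ _))
  | skip _ _ ih => simpa using ih

theorem letters_sublist (h : Overruns ts q) (hts : IsCoherent ts)
    (hn : numOneWay q = numOneWay (letters ts)) : letters ts <+ q := by
  induction h with
  | nil => simp
  | hit _ ih => exact (ih hts.tail (by simpa using hn)).cons_cons _
  | @stay _ c _ _ _ h ih =>
    have hle := h.numOneWay_letters_le
    rcases c.eq_star_or_oneWay with rfl | ⟨b, rfl⟩
    · exact (ih hts (by simpa using hn)).cons _
    · simp only [numOneWay_oneWay_cons] at hn; omega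
  | @take _ c _ _ _ h ih =>
    have hle := h.numOneWay_letters_le
    rcases c.eq_star_or_oneWay with rfl | ⟨b, rfl⟩
    · exact (ih hts.tail (by simpa using hn)).cons_cons _
    · simp only [letters_cons, OrientedLetter.letter_twoWay, numOneWay_star_cons,
        numOneWay_oneWay_cons] at hn
      omega
  | @skip s c ts q hc h ih =>
    -- All one-way letters of `c :: q` are letters of `ts`, so `ts` starts with `c`; this is
    -- incoherent.
    obtain rfl := Letter.not_allows_iff.1 hc
    have hsub := ih hts.tail (by simpa using hn)
    rcases ts with _ | ⟨t, ts⟩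
    · simp at hn
    rcases cons_sublist_cons'.1 hsub with hsub | ⟨ht, -⟩
    · have : numOneWay (letters (t :: ts)) ≤ numOneWay q := numOneWay_le_of_sublist hsub
      simp only [letters_cons t, letters_cons (twoWay s), OrientedLetter.letter_twoWay,
        numOneWay_star_cons, numOneWay_oneWay_cons] at hn this
      omega
    · have hagree := (isChain_cons_cons.1 hts).1
      cases t
      · simp_all [OrientedLetter.Agrees]
      · exact absurd ht.symm (oneWay_ne_star _)

theorem numOneWay_letters_lt (h : Overruns ts q) (hts : IsCoherent ts)
    (hlen : q.length < ts.length) : numOneWay (letters ts) < numOneWay q := by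
  refine h.numOneWay_letters_le.lt_of_ne fun hn ↦ ?_
  have := (h.letters_sublist hts hn.symm).length_le
  rw [length_letters] at this
  omega

/-- A letter that is skipped by one `*` is read after a run of such `*`. -/
theorem exists_run {c : Bool} : ∀ {ts : List OrientedLetter}, IsCoherent ts →
    (∀ a ts', ts = .oneWay a :: ts' → a ≠ c) → Overruns ts (oneWay c :: q) →
    ∃ (l : List Bool) (B : _), ts = l.map twoWay ++ B ∧ Overruns B q ∧ ∀ v ∈ l.dropLast, v = !c
  | [], _, _, _ => ⟨[], [], rfl, .nil q, by simp⟩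
  | .oneWay a :: ts, _, hhead, h => by
    have hac : a ≠ c := hhead a ts rfl
    generalize hp : oneWay c :: q = p at h
    cases h with
    | hit h => simp_all
    | stay _ h =>
      obtain ⟨rfl, rfl⟩ := cons_eq_cons.1 hp
      exact ⟨[], _, rfl, h, by simp⟩
  | .twoWay s :: ts, hts, hhead, h => by
    generalize hp : oneWay c :: q = p at h
    cases h with
    | take _ h =>
      obtain ⟨rfl, rfl⟩ := cons_eq_cons.1 hp
      exact ⟨[s], ts, rfl, h, by simp⟩
    | skip hc h =>
      obtain ⟨rfl, rfl⟩ := cons_eq_cons.1 hp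
      obtain rfl : c = !s := by simpa using Letter.not_allows_iff.1 hc
      obtain ⟨l, B, rfl, hB, hl⟩ := exists_run hts.tail
        (by rintro a ts' rfl; simpa using (isChain_cons_cons.1 hts).1.symm) h
      refine ⟨s :: l, B, rfl, hB, fun v hv ↦ ?_⟩
      rcases l with _ | ⟨v', l⟩
      · simp at hv
      · rcases mem_cons.1 hv with rfl | hv
        exacts [(Bool.not_not _).symm, hl v hv]

theorem exists_split (h : Overruns ts q) (hts : IsCoherent ts)
    (hn : numOneWay q = numOneWay (letters ts) + 1) (hlen : q.length < ts.length) :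
    ∃ (A B : List OrientedLetter) (l : List Bool) (e : Bool) (A' B' : Word),
      ts = A ++ map twoWay l ++ B ∧ q = A' ++ oneWay e :: B' ∧ 2 ≤ l.length ∧
      letters A <+ A' ∧ letters B <+ B' ∧ ∀ v ∈ l.dropLast, v = !e := by
  induction h with
  | nil => simp at hlen
  | hit _ ih =>
    obtain ⟨A, B, l, e, A', B', rfl, rfl, hl, hA, hB, hv⟩ :=
      ih hts.tail (by simpa using hn) (by simpa using hlen)
    exact ⟨_ :: A, B, l, e, _ :: A', B', rfl, rfl, hl, hA.cons_cons _, hB, hv⟩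
  | @stay a c ts q hc h ih =>
    rcases c.eq_star_or_oneWay with rfl | ⟨b, rfl⟩
    · obtain ⟨A, B, l, e, A', B', hsplit, rfl, hl, hA, hB, hv⟩ :=
        ih hts (by simpa using hn) (by rw [length_cons] at hlen; omega)
      exact ⟨A, B, l, e, _ :: A', B', hsplit, rfl, hl, hA.cons _, hB, hv⟩
    · have := (h.letters_sublist hts (by simpa using hn)).length_le
      simp only [length_letters, length_cons] at this hlen
      omega
  | @take s c ts q hc h ih =>
    rcases c.eq_star_or_oneWay with rfl | ⟨b, rfl⟩
    · obtain ⟨A, B, l, e, A', B', rfl, rfl, hl, hA, hB, hv⟩ :=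
        ih hts.tail (by simpa using hn) (by simpa using hlen)
      exact ⟨_ :: A, B, l, e, _ :: A', B', rfl, rfl, hl, hA.cons_cons _, hB, hv⟩
    · have := (h.letters_sublist hts.tail (by simpa using hn)).length_le
      simp only [length_letters, length_cons] at this hlen
      omega
  | @skip s c ts q hc h ih =>
    obtain rfl := Letter.not_allows_iff.1 hc
    obtain ⟨l, B, hsplit, hB, hv⟩ := exists_run hts (by simp) (.skip hc h)
    rw [hsplit] at hts hn hlen ⊢
    have hsub := hB.letters_sublist hts.right_of_append (by simpa using hn)
    have hle := hsub.length_le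
    simp only [length_letters, length_append, length_map, length_cons] at hle hlen
    exact ⟨[], B, l, !s, [], q, rfl, rfl, by omega, .slnil, hsub, hv⟩

end Crossing

end Overruns

open Classical in
/-- Between two prescribed places of a run, the signs alternate backwards from the second one; after
the last prescribed place of the run, they alternate forwards. -/
theorem exists_signs (r : Word) : ∀ (J : ℕ → Prop) (c : ℕ → Bool) (v₀ : Bool),
    (∀ p, J p → r[p]? = some .star) → ∃ s : ℕ → Bool, (∀ p, J p → s p = c p) ∧
      (∀ p, r[p]? = some .star → r[p + 1]? = some .star → s (p + 1) = (!s p) ∨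
        (J p ∧ ∃ p' > p, J p' ∧ ∀ y, p ≤ y → y ≤ p' → r[y]? = some .star)) ∧
      (r[0]? = some .star → (¬ ∃ p', J p' ∧ ∀ y ≤ p', r[y]? = some .star) → s 0 = v₀) := by
  induction r with
  | nil => exact fun J c v₀ hJ ↦ ⟨fun _ ↦ v₀, fun p hp ↦ by simpa using hJ p hp, by simp, by simp⟩
  | cons x r ih =>
    intro J c v₀ hJ
    let d := if J 0 then c 0 else v₀
    obtain ⟨s, hsJ, hs, hs₀⟩ := ih (fun p ↦ J (p + 1)) (fun p ↦ c (p + 1)) (!d)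
      fun p hp ↦ by simpa using hJ _ hp
    let R := ∃ p, J (p + 1) ∧ ∀ y ≤ p, r[y]? = some .star
    let s' : ℕ → Bool := fun | 0 => if ¬ J 0 ∧ R then !s 0 else d | p + 1 => s p
    refine ⟨s', ?_, ?_, ?_⟩
    · rintro (_ | p) hp
      · simp [s', d, hp]
      · exact hsJ p hp
    · rintro (_ | p) hp hp₁
      · by_cases hR : R
        · by_cases hJ₀ : J 0
          · obtain ⟨p, hJp, hrun⟩ := hR
            refine .inr ⟨hJ₀, p + 1, p.succ_pos, hJp, ?_⟩
            rintro (_ | y) - hy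
            · exact hp
            · simpa using hrun y (by omega)
          · left; simp [s', hJ₀, hR]
        · left; simp [s', hR, hs₀ (by simpa using hp₁) hR]
      · rcases hs p (by simpa using hp) (by simpa using hp₁) with h | ⟨hJp, p', hlt, hJp', hrun⟩
        · exact .inl h
        · refine .inr ⟨hJp, p' + 1, by omega, hJp', ?_⟩
          rintro (_ | y) h₁ h₂
          · omega
          · simpa using hrun y (by omega) (by omega)
    · intro h₀ hno
      have hJ₀ : ¬ J 0 := fun h ↦ hno ⟨0, h, fun y hy ↦ by simpa [Nat.le_zero.1 hy] using hJ 0 h⟩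
      by_cases hR : R
      · obtain ⟨p, hJp, hrun⟩ := hR
        refine (hno ⟨p + 1, hJp, ?_⟩).elim
        rintro (_ | y) hy
        · exact h₀
        · simpa using hrun y (by omega)
      · simp [s', d, hJ₀, hR]

theorem exists_orientation (r : Word) : ∀ s : ℕ → Bool, ∃ ts, letters ts = r ∧ IsCoherent ts ∧
    ∀ p v, ts[p]? = some (twoWay v) → r[p + 1]? = some .star → v = s p := by
  induction r with
  | nil => exact fun s ↦ ⟨[], rfl, .nil, by simp⟩
  | cons x r ih =>
    intro s
    obtain ⟨ts, rfl, hts, hs⟩ := ih fun p ↦ s (p + 1)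
    obtain ⟨x, rfl, hx, hv⟩ : ∃ t, OrientedLetter.letter t = x ∧ IsCoherent (t :: ts) ∧
        ∀ v, t = twoWay v → (letters ts)[0]? = some .star → v = s 0 := by
      rcases x.eq_star_or_oneWay with rfl | ⟨a, rfl⟩
      · rcases ts with _ | ⟨⟨a⟩ | _, ts⟩
        · exact ⟨twoWay (s 0), rfl, .singleton _, by simp⟩
        · exact ⟨twoWay a, rfl, .cons_cons rfl hts, by simp⟩
        · exact ⟨twoWay (s 0), rfl, .cons_cons trivial hts, by simp +contextual⟩
      · refine ⟨.oneWay a, rfl, ?_, by simp⟩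
        cases ts with
        | nil => exact .singleton _
        | cons t ts => exact .cons_cons trivial hts
    refine ⟨x :: ts, rfl, hx, ?_⟩
    rintro (_ | p) v h h'
    · exact hv v (by simpa using h) (by simpa using h')
    · exact hs p v (by simpa using h) (by simpa using h')

/-! ### Runs of `*` in cyclic words -/

section Runs

/-- The length of the run of `*` with which a word starts. -/
def leadingRun : Word → ℕ
  | .star :: q => leadingRun q + 1
  | _ => 0

/-- The lengths, possibly `0`, of the runs of `*` that follow the one-way letters of a word. -/
def laterRuns : Word → List ℕ
  | [] => []
  | .star :: q => laterRuns q
  | _ :: q => leadingRun q :: laterRuns q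

@[simp] theorem leadingRun_nil : leadingRun [] = 0 := rfl

@[simp] theorem leadingRun_star_cons (q : Word) : leadingRun (.star :: q) = leadingRun q + 1 := rfl

@[simp] theorem leadingRun_oneWay_cons (a : Bool) (q : Word) : leadingRun (oneWay a :: q) = 0 := by
  cases a <;> rfl

@[simp] theorem laterRuns_nil : laterRuns [] = [] := rfl

@[simp] theorem laterRuns_star_cons (q : Word) : laterRuns (.star :: q) = laterRuns q := rfl

@[simp] theorem laterRuns_oneWay_cons (a : Bool) (q : Word) :
    laterRuns (oneWay a :: q) = leadingRun q :: laterRuns q := by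
  cases a <;> rfl

@[simp] theorem leadingRun_replicate_append (k : ℕ) (q : Word) :
    leadingRun (replicate k .star ++ q) = k + leadingRun q := by
  induction k with
  | zero => simp
  | succ k ih => rw [replicate_succ, cons_append, leadingRun_star_cons, ih]; ring

@[simp] theorem laterRuns_replicate_append (k : ℕ) (q : Word) :
    laterRuns (replicate k .star ++ q) = laterRuns q := by
  induction k with
  | zero => rfl
  | succ k ih => rw [replicate_succ, cons_append, laterRuns_star_cons, ih]

@[simp] theorem leadingRun_append_oneWay_cons (p : Word) (a : Bool) (q : Word) :
    leadingRun (p ++ oneWay a :: q) = leadingRun p := by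
  induction p with
  | nil => simp
  | cons x p ih => rcases x.eq_star_or_oneWay with rfl | ⟨b, rfl⟩ <;> simp [ih]

@[simp] theorem laterRuns_append_oneWay_cons (p : Word) (a : Bool) (q : Word) :
    laterRuns (p ++ oneWay a :: q) = laterRuns p ++ leadingRun q :: laterRuns q := by
  induction p with
  | nil => simp
  | cons x p ih => rcases x.eq_star_or_oneWay with rfl | ⟨b, rfl⟩ <;> simp [ih]

theorem leadingRun_replicate (k : ℕ) : leadingRun (replicate k .star) = k := by
  simpa using leadingRun_replicate_append k []

theorem laterRuns_replicate (k : ℕ) : laterRuns (replicate k .star) = [] := by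
  simpa using laterRuns_replicate_append k []

theorem eq_replicate_or_exists_last_oneWay (q : Word) : (∃ k, q = replicate k .star) ∨
    ∃ p a k, q = p ++ oneWay a :: replicate k .star := by
  induction q with
  | nil => exact .inl ⟨0, rfl⟩
  | cons x q ih =>
    rcases ih with ⟨k, rfl⟩ | ⟨p, a, k, rfl⟩
    · rcases x.eq_star_or_oneWay with rfl | ⟨a, rfl⟩
      · exact .inl ⟨k + 1, rfl⟩
      · exact .inr ⟨[], a, k, rfl⟩
    · exact .inr ⟨x :: p, a, k, rfl⟩

theorem laterRuns_isRotated {p q : Word} {a b : Bool} (h : oneWay a :: p ~r oneWay b :: q) :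
    laterRuns (oneWay a :: p) ~r laterRuns (oneWay b :: q) := by
  obtain ⟨k, hk, h⟩ := isRotated_iff_mod.1 h
  rw [rotate_eq_drop_append_take hk] at h
  rw [← take_append_drop k (oneWay a :: p), ← h]
  rcases hX : take k (oneWay a :: p) with _ | ⟨x, X⟩ <;>
    rcases hY : drop k (oneWay a :: p) with _ | ⟨y, Y⟩
  · exact .refl _
  · simp [IsRotated.refl]
  · simp [IsRotated.refl]
  · obtain rfl : x = oneWay a := by
      have := congrArg head? (take_append_drop k (oneWay a :: p))
      simpa [hX] using this
    obtain rfl : y = oneWay b := by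
      rw [hY, cons_append] at h
      exact (cons.inj h).1
    simpa using isRotated_append (l := laterRuns (oneWay a :: X))
      (l' := laterRuns (oneWay b :: Y))

theorem runs_le_of_sublist {p q : Word} (h : p <+ q) (hn : numOneWay q ≤ numOneWay p) :
    leadingRun p ≤ leadingRun q ∧ Forall₂ (· ≤ ·) (laterRuns p) (laterRuns q) := by
  induction h with
  | slnil => simp
  | @cons p q x h ih =>
    rcases x.eq_star_or_oneWay with rfl | ⟨a, rfl⟩
    · obtain ⟨h₁, h₂⟩ := ih (by simpa using hn)
      exact ⟨h₁.trans (Nat.le_succ _), h₂⟩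
    · have := numOneWay_le_of_sublist h
      simp only [numOneWay_oneWay_cons] at hn
      omega
  | @cons_cons _ _ x _ ih =>
    rcases x.eq_star_or_oneWay with rfl | ⟨a, rfl⟩ <;> simpa using ih (by simpa using hn)

theorem exists_laterRuns_ge {p R : Word} {a : Bool} {t : ℕ}
    (h : oneWay a :: p ~r replicate t .star ++ R) : ∃ g ∈ laterRuns (oneWay a :: p), t ≤ g := by
  rcases eq_replicate_or_exists_last_oneWay R with ⟨k, rfl⟩ | ⟨R, b, k, rfl⟩
  · have : oneWay a ∈ replicate t Letter.star ++ replicate k .star := h.mem_iff.1 mem_cons_self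
    simp [oneWay_ne_star] at this
  · have hrot : oneWay a :: p ~r oneWay b :: (replicate k .star ++ (replicate t .star ++ R)) := by
      rw [← append_assoc] at h
      exact h.trans isRotated_append
    exact ⟨k + (t + leadingRun R), (laterRuns_isRotated hrot).mem_iff.2 (by simp), by omega⟩

end Runs

section Rotation

open scoped Fin.CommRing

/-- From any place one reaches `α` in steps of `κ`, since otherwise the steps from `α + 1` would
close up without passing through `α`. -/
theorem le_of_le_rotation {m : ℕ} [NeZero m] (f : Fin m → ℕ) {κ α : Fin m}
    (h : ∀ i ≠ α, f i ≤ f (i + κ)) (hlt : f (α + 1) < f (α + 1 + κ)) (i : Fin m) : f i ≤ f α := by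
  obtain ⟨l, hl⟩ : ∃ l : ℕ, α + 1 + l * κ = α := by
    by_contra! hne
    have hmono : ∀ l : ℕ, f (α + 1 + κ) ≤ f (α + 1 + (l + 1 : ℕ) * κ) := by
      intro l
      induction l with
      | zero => simp
      | succ l ih =>
        refine (ih.trans (h _ (hne _))).trans_eq (congrArg f ?_)
        push_cast
        ring
    have := hmono (m - 1)
    rw [Nat.sub_add_cancel (NeZero.one_le (n := m)), CharP.cast_eq_zero, zero_mul, add_zero] at this
    omega
  by_contra! hi
  have hclimb : ∀ k : ℕ, f α < f (i + k * κ) := by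
    intro k
    induction k with
    | zero => simpa using hi
    | succ k ih =>
      refine (ih.trans_le (h _ fun hk ↦ ih.ne' (congrArg f hk))).trans_eq (congrArg f ?_)
      push_cast
      ring
  refine (hclimb ((i - α : Fin m) * l)).ne' (congrArg f ?_)
  push_cast
  linear_combination (i - α) * hl

theorem le_last_of_isRotated {x y z i : ℕ} {L M : List ℕ}
    (hrot : x :: (L ++ [z]) ~r y :: M) (hxy : x < y) (hLM : Forall₂ (· ≤ ·) (L ++ [i]) M) :
    ∀ g ∈ x :: (L ++ [z]), g ≤ z := by
  obtain ⟨κ, hκ⟩ := hrot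
  let f : Fin (L.length + 2) → ℕ := fun j ↦ (x :: (L ++ [z]))[j]
  have hlen : (y :: M).length = L.length + 2 := by simp [← hLM.length_eq]
  have hf : ∀ j : Fin (L.length + 2), f (j + κ) = (y :: M)[j] := by
    intro j
    simp [f, ← hκ, getElem_rotate, Fin.val_add]
  have hmax := le_of_le_rotation f (κ := κ) (α := Fin.last _) ?_ ?_
  · intro g hg
    obtain ⟨j, hj, rfl⟩ := getElem_of_mem hg
    exact (hmax ⟨j, by simpa [Nat.lt_succ_iff] using hj⟩).trans_eq (by simp [f])
  · intro j hj
    have hle := (forall₂_iff_get.1 (hLM.cons hxy.le)).2 j (by simp; omega) (by omega)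
    refine (le_of_eq_of_le ?_ hle).trans_eq (hf j).symm
    obtain ⟨_ | j, hj'⟩ := j
    · simp [f]
    · have : j < L.length := lt_of_le_of_ne (by omega) fun h ↦ hj (Fin.ext (by simp [h]))
      simp [f, this]
  · rw [hf]
    simpa [f] using hxy

end Rotation

theorem isRotated_of_eq_append {α : Type*} {p q : List α} (u v : List α) (hp : p = u ++ v)
    (hq : q = v ++ u) : p ~r q :=
  hp ▸ hq ▸ isRotated_append

/-- After rotation, in each word the last run of `*` is the one that ends at the letter `e` or `e'`.
All other runs of the first word are at most as long as the corresponding ones of the second, so the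
last run of the first word has to be the longest. -/
theorem not_isRotated_of_shift {A B A' B' R : Word} {i l t : ℕ} {a e e' : Bool}
    (hA : A ++ oneWay a :: replicate i .star <+ A') (hB : .star :: B <+ B')
    (hn : numOneWay A' + numOneWay B' ≤ numOneWay A + numOneWay B + 1) (ht : i + l < t)
    (hrun : A ++ oneWay a :: replicate (i + l) .star ++ oneWay e' :: B ++ [.star, .star] ~r
      replicate t .star ++ R) :
    ¬ A ++ oneWay a :: replicate (i + l) .star ++ oneWay e' :: B ++ [.star, .star] ~r
      A' ++ oneWay e :: B' ++ [.star, .star] := by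
  intro h
  set X : Word := B ++ [.star, .star] ++ A
  set Y : Word := B' ++ [.star, .star] ++ A'
  have hV : A ++ oneWay a :: replicate (i + l) .star ++ oneWay e' :: B ++ [.star, .star] ~r
      oneWay e' :: (X ++ oneWay a :: replicate (i + l) .star) :=
    isRotated_of_eq_append (A ++ oneWay a :: replicate (i + l) .star)
      (oneWay e' :: B ++ [.star, .star]) (by simp) (by simp [X])
  have hU : A' ++ oneWay e :: B' ++ [.star, .star] ~r oneWay e :: Y :=
    isRotated_of_eq_append A' (oneWay e :: B' ++ [.star, .star]) (by simp) (by simp [Y])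
  have hXY : .star :: (X ++ oneWay a :: replicate i .star) <+ Y := by
    simpa [X, Y] using (hB.append (.refl [Letter.star, .star])).append hA
  obtain ⟨hlead, hlater⟩ := runs_le_of_sublist hXY (by simp [X, Y]; omega)
  obtain ⟨g, hg, htg⟩ := exists_laterRuns_ge (hV.symm.trans hrun)
  have hrot := laterRuns_isRotated ((hV.symm.trans h).trans hU)
  simp only [leadingRun_star_cons, laterRuns_star_cons, leadingRun_append_oneWay_cons,
    laterRuns_append_oneWay_cons, laterRuns_oneWay_cons, leadingRun_replicate,
    laterRuns_replicate] at hlead hlater hrot hg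
  exact ((le_last_of_isRotated hrot hlead hlater g hg).trans_lt (ht.trans_le htg)).false

/-- The word read along the same arcs in the opposite direction. -/
def opposite (q : Word) : Word := (q.map Letter.flip).reverse

@[simp] theorem opposite_nil : opposite [] = [] := rfl

@[simp] theorem opposite_append (p q : Word) : opposite (p ++ q) = opposite q ++ opposite p := by
  simp [opposite]

@[simp] theorem opposite_cons (c : Letter) (q : Word) :
    opposite (c :: q) = opposite q ++ [c.flip] := by
  simp [opposite]

@[simp] theorem opposite_opposite (q : Word) : opposite (opposite q) = q := by
  simp [opposite, map_reverse, Function.comp_def]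

@[simp] theorem opposite_replicate_star (k : ℕ) :
    opposite (replicate k .star) = replicate k .star := by
  simp [opposite]

@[simp] theorem length_opposite (q : Word) : (opposite q).length = q.length := by
  simp [opposite]

@[simp] theorem numOneWay_opposite (q : Word) : numOneWay (opposite q) = numOneWay q := by
  induction q with
  | nil => rfl
  | cons c q ih => rcases c.eq_star_or_oneWay with rfl | ⟨a, rfl⟩ <;> simp [ih]

theorem opposite_isRotated {p q : Word} (h : p ~r q) : opposite p ~r opposite q :=
  (h.map _).reverse

theorem laterRuns_opposite_perm (a : Bool) (q : Word) : ∀ k : ℕ,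
    laterRuns (oneWay a :: (opposite q ++ replicate k .star)) ~
      (leadingRun q + k) :: laterRuns q := by
  induction q with
  | nil => intro k; simp [leadingRun_replicate, laterRuns_replicate]
  | cons c q ih =>
    intro k
    rcases c.eq_star_or_oneWay with rfl | ⟨b, rfl⟩
    · have := ih (k + 1)
      simpa [replicate_succ, add_assoc, add_comm 1] using this
    · have := ((ih 0).append_right [k]).trans (perm_append_singleton _ _)
      simpa [leadingRun_replicate, laterRuns_replicate] using this

/-- The word `W` read forwards or backwards. -/
def reading (W : Word) (τ : Bool) : Word := if τ then W else opposite W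

@[simp] theorem length_reading (W : Word) (τ : Bool) : (reading W τ).length = W.length := by
  cases τ <;> simp [reading]

@[simp] theorem numOneWay_reading (W : Word) (τ : Bool) :
    numOneWay (reading W τ) = numOneWay W := by
  cases τ <;> simp [reading]

theorem reading_isRotated_replicate_append (P Q : Word) (t : ℕ) (τ : Bool) :
    ∃ R, reading (P ++ replicate t .star ++ Q) τ ~r replicate t .star ++ R := by
  cases τ
  · refine ⟨opposite P ++ opposite Q, ?_⟩
    exact isRotated_of_eq_append (opposite Q) (replicate t .star ++ opposite P)
      (by simp [reading]) (by simp)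
  · refine ⟨Q ++ P, ?_⟩
    exact isRotated_of_eq_append P (replicate t .star ++ Q) (by simp [reading]) (by simp)

/-- The cyclic word `q` is `W`, read forwards or backwards. -/
def IsReading (W q : Word) : Prop := ∃ τ, q ~r reading W τ

section Exchange

variable {A B A' B' : Word}

theorem isReading_replicate (M : ℕ) (b e : Bool) :
    IsReading (replicate (M + 2) .star ++ [oneWay b])
      (oneWay e :: replicate M .star ++ [.star, .star]) := by
  have hM : replicate M Letter.star ++ [.star, .star] = replicate (M + 2) .star :=
    (replicate_add M 2 _).symm
  rw [cons_append, hM]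
  by_cases h : e = b
  · exact ⟨true, isRotated_of_eq_append [oneWay e] _ rfl (by rw [h]; rfl)⟩
  · obtain rfl : e = !b := Bool.eq_not.2 h
    exact ⟨false, by simp [reading, IsRotated.refl]⟩

theorem laterRuns_perm_of_isReading {p q : Word} {a b : Bool}
    (h : IsReading (q ++ [oneWay b]) (oneWay a :: p)) :
    leadingRun p :: laterRuns p ~ leadingRun q :: laterRuns q := by
  obtain ⟨_ | _, h⟩ := h
  · have hperm := laterRuns_opposite_perm (!b) q 0
    have hrot : oneWay a :: p ~r oneWay (!b) :: opposite q := by simpa [reading] using h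
    simpa using (laterRuns_isRotated hrot).perm.trans (by simpa using hperm)
  · have hrot : oneWay a :: p ~r oneWay b :: q := h.trans isRotated_append
    simpa using (laterRuns_isRotated hrot).perm

theorem leadingRun_eq_of_isReading {p u : ℕ} {a b e : Bool} {Q : Word}
    (h : IsReading (replicate (p + 2) .star ++ (Q ++ oneWay a :: replicate u .star) ++ [oneWay b])
      (replicate p .star ++ oneWay e :: (Q ++ oneWay a :: replicate u .star) ++ [.star, .star])) :
    leadingRun Q = u := by
  have hrot : replicate p .star ++ oneWay e :: (Q ++ oneWay a :: replicate u .star) ++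
      [.star, .star] ~r oneWay e :: (Q ++ oneWay a :: replicate (u + 2 + p) .star) :=
    isRotated_of_eq_append (replicate p .star)
      (oneWay e :: (Q ++ oneWay a :: replicate u .star) ++ [.star, .star]) (by simp)
      (by simp [replicate_add])
  have hperm := laterRuns_perm_of_isReading (h.imp fun _ ↦ hrot.symm.trans)
  simp only [leadingRun_append_oneWay_cons, laterRuns_append_oneWay_cons, leadingRun_replicate,
    laterRuns_replicate, leadingRun_replicate_append, laterRuns_replicate_append] at hperm
  have hpair : [leadingRun Q, u + 2 + p] ~ [p + 2 + leadingRun Q, u] :=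
    (perm_append_left_iff _).1 (perm_middle.trans (hperm.trans perm_middle.symm))
  have := hpair.mem_iff.1 mem_cons_self
  simp only [mem_cons, not_mem_nil, or_false] at this
  omega

theorem count_plus_eq_of_sublist {p q : Word} (h : p <+ q) (hn : numOneWay q ≤ numOneWay p) :
    p.count .plus = q.count .plus := by
  induction h with
  | slnil => rfl
  | @cons p q x h ih =>
    rcases x.eq_star_or_oneWay with rfl | ⟨a, rfl⟩
    · simpa using ih (by simpa using hn)
    · have := numOneWay_le_of_sublist h
      simp only [numOneWay_oneWay_cons] at hn
      omega
  | @cons_cons _ _ x _ ih =>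
    rw [count_cons, count_cons]
    rcases x.eq_star_or_oneWay with rfl | ⟨a, rfl⟩ <;> rw [ih (by simpa using hn)]

theorem eq_of_isRotated_exchange {C D : Word} {k : ℕ} {e e' : Bool} (hA : A <+ A') (hB : B <+ B')
    (hn : numOneWay A' + numOneWay B' ≤ numOneWay A + numOneWay B)
    (hr : A ++ replicate k .star ++ B = C ++ [.star, .star] ++ D)
    (h : A' ++ oneWay e :: B' ++ [.star, .star] ~r C ++ oneWay e' :: D ++ [.star, .star]) :
    e = e' := by
  have hA' := count_plus_eq_of_sublist hA (by have := numOneWay_le_of_sublist hB; omega)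
  have hB' := count_plus_eq_of_sublist hB (by have := numOneWay_le_of_sublist hA; omega)
  have hr' := congrArg (count .plus) hr
  have h' := h.perm.count_eq .plus
  have honeWay (a : Bool) : (if oneWay a = Letter.plus then 1 else 0) = a.toNat := by
    cases a <;> rfl
  simp only [count_append, count_cons, count_nil, count_replicate, beq_iff_eq, reduceCtorEq,
    if_false, honeWay] at hr' h'
  cases e <;> cases e' <;> simp at h' ⊢ <;> omega

theorem not_isReading_of_inner_run {W B₂ : Word} {a b e e' : Bool} {i k l : ℕ} (hk : 0 < k)
    (hW : W = A ++ oneWay a :: replicate (i + (k + 2)) .star ++ B₂ ++ [oneWay b])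
    (hA : A ++ oneWay a :: replicate i .star <+ A') (hB : B <+ B')
    (hn : numOneWay A' + numOneWay B' ≤ numOneWay A + 1 + numOneWay B)
    (hl : replicate l .star ++ B = replicate (k + 2) .star ++ B₂) (he : k + 1 < l → e' = !e)
    (h : IsReading W (A' ++ oneWay e :: B' ++ [.star, .star]))
    (h₁ : IsReading W (A ++ oneWay a :: replicate i .star ++
      oneWay (!e) :: (replicate k .star ++ B₂) ++ [.star, .star])) :
    ¬ IsReading W (A ++ oneWay a :: replicate (i + k) .star ++ oneWay e' :: B₂ ++
      [.star, .star]) := by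
  rintro ⟨τ₂, h₂⟩
  obtain ⟨τ, h⟩ := h
  obtain ⟨τ₁, h₁⟩ := h₁
  obtain ⟨R, hR⟩ := reading_isRotated_replicate_append (A ++ [oneWay a]) (B₂ ++ [oneWay b])
    (i + (k + 2)) τ₂
  replace hR : reading W τ₂ ~r replicate (i + (k + 2)) .star ++ R := by simpa [hW] using hR
  have hr : (A ++ oneWay a :: replicate i .star) ++ replicate l .star ++ B =
      (A ++ oneWay a :: replicate i .star) ++ [.star, .star] ++ (replicate k .star ++ B₂) := by
    rw [append_assoc _ _ B, hl]
    simp [replicate_succ]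
  have hne₁₂ : τ₁ ≠ τ₂ := by
    rintro rfl
    refine not_isRotated_of_shift (.refl _) ?_ ?_ (by omega) (h₂.trans hR) (h₂.trans h₁.symm)
    · obtain ⟨k, rfl⟩ := Nat.exists_eq_succ_of_ne_zero hk.ne'
      exact (sublist_append_right _ _).cons_cons _
    · simp
      omega
  have hne₁ : τ ≠ τ₁ := by
    rintro rfl
    have := eq_of_isRotated_exchange hA hB (by simpa using hn) hr (h.trans h₁.symm)
    simp at this
  obtain rfl : τ = τ₂ := (Bool.eq_not.2 hne₁).trans (Bool.eq_not.2 hne₁₂.symm).symm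
  obtain rfl : e = e' := by
    refine eq_of_isRotated_exchange (k := l) hA hB (by simpa using hn) ?_ (h.trans h₂.symm)
    rw [append_assoc _ _ B, hl, replicate_add, replicate_add]
    simp only [append_assoc, cons_append]
    rfl
  have hlk : l ≤ k + 1 := by
    by_contra! hlt
    simpa using he hlt
  have hB₂ : numOneWay B = numOneWay B₂ := by simpa using congrArg numOneWay hl
  obtain ⟨j, hj⟩ : ∃ j, k + 2 = l + (j + 1) := ⟨k + 1 - l, by omega⟩
  refine not_isRotated_of_shift hA (.trans ?_ hB) (by omega) (by omega) (h₂.trans hR)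
    (h₂.trans h.symm)
  rw [hj, replicate_add, append_assoc, append_right_inj, replicate_succ] at hl
  exact hl ▸ (sublist_append_right _ _).cons_cons _

end Exchange

theorem IsReading.length_eq {W q : Word} (h : IsReading W q) : q.length = W.length := by
  obtain ⟨τ, h⟩ := h
  exact h.perm.length_eq.trans (length_reading W τ)

theorem IsReading.numOneWay_eq {W q : Word} (h : IsReading W q) : numOneWay q = numOneWay W := by
  obtain ⟨τ, h⟩ := h
  exact (h.perm.countP_eq _).trans (numOneWay_reading W τ)

/-! ### Exchanging `**` for a one-way letter -/

section FactorsForce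

variable {r : Word} {x : Letter}

/-- Every pattern of directions into which all factors `q` of length `|W| - 2` of the cyclic word
`W` embed also contains `r`. -/
def FactorsForce (W r : Word) : Prop :=
  ∀ w : List Bool, (∀ q y z, IsReading W (q ++ [y, z]) → Embeds q w) → Embeds r w

theorem FactorsForce.exists_overruns {ts : List OrientedLetter}
    (H : FactorsForce (letters ts ++ [x]) (letters ts)) (hts : IsCoherent ts) (hne : ts ≠ []) :
    ∃ b q, x = oneWay b ∧ Overruns ts q ∧ numOneWay q = numOneWay (letters ts) + 1 ∧
      q.length < ts.length ∧ IsReading (letters ts ++ [x]) (q ++ [.star, .star]) := by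
  set w := crossingPattern ts.length ts with hw
  have hw₀ : w ≠ [] := by
    rcases ts with _ | ⟨_ | _, _⟩ <;> simp_all
  obtain ⟨q, y, z, hq, hqw⟩ : ∃ q y z, IsReading (letters ts ++ [x]) (q ++ [y, z]) ∧
      ¬ Embeds q w.dropLast := by
    by_contra! h
    exact not_embeds_crossingPattern _ _ ((embeds_dropLast_iff hw₀).1 (H _ h))
  have hlen : q.length + 1 = ts.length := by simpa using hq.length_eq
  have hover : Overruns ts q :=
    .of_not_embeds (N := ts.length) (by omega) (by rwa [embeds_dropLast_iff hw₀] at hqw)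
  have hlt := hover.numOneWay_letters_lt hts (by omega)
  have hnum := hq.numOneWay_eq
  rcases x.eq_star_or_oneWay with rfl | ⟨b, rfl⟩ <;>
    rcases y.eq_star_or_oneWay with rfl | ⟨c, rfl⟩ <;>
    rcases z.eq_star_or_oneWay with rfl | ⟨d, rfl⟩ <;>
    simp only [numOneWay_append, numOneWay_star_cons, numOneWay_oneWay_cons,
      numOneWay_nil] at hnum <;> try omega
  exact ⟨b, q, rfl, hover, hnum, by omega, hq⟩

theorem FactorsForce.exists_isReading (H : FactorsForce (r ++ [x]) r) (hr : r ≠ [])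
    (s : ℕ → Bool) : ∃ b A B L e A' B', x = oneWay b ∧ r = A ++ replicate L .star ++ B ∧ 2 ≤ L ∧
      A <+ A' ∧ B <+ B' ∧ numOneWay A' + numOneWay B' = numOneWay A + numOneWay B ∧
      IsReading (r ++ [x]) (A' ++ oneWay e :: B' ++ [.star, .star]) ∧
      ∀ i, i + 1 < L → s (A.length + i) = !e := by
  obtain ⟨ts, rfl, hts, hs⟩ := exists_orientation r s
  obtain ⟨b, q, rfl, hover, hn, hlen, hq⟩ := H.exists_overruns hts (by rintro rfl; simp at hr)
  obtain ⟨A, B, l, e, A', B', rfl, rfl, hl, hA, hB, hle⟩ := hover.exists_split hts hn hlen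
  refine ⟨b, letters A, letters B, l.length, e, A', B', rfl, by simp, hl, hA, hB, ?_, hq, ?_⟩
  · simp only [numOneWay_append, numOneWay_oneWay_cons, letters_append, letters_map_twoWay,
      numOneWay_replicate_star] at hn
    omega
  · intro i hi
    have hv : l[i] = !e :=
      hle _ (mem_iff_getElem.2 ⟨i, by rw [length_dropLast]; omega, getElem_dropLast _⟩)
    have hi' : i < l.length := by omega
    rw [length_letters, ← hv, hs (A.length + i) l[i]]
    · simp [getElem?_append, hi']
    · simp [add_assoc, hi, getElem?_append_right, getElem?_append_left]

/-- One letter `e` in place of the two letters `*` at positions `p` and `p + 1` of `r`, and two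
letters `*` in place of the letter `x` after `r`, do not change the cyclic word `r ++ [x]`, up to
reversal. -/
def IsExchange (r : Word) (x : Letter) (p : ℕ) (e : Bool) : Prop :=
  ∃ A B, A.length = p ∧ r = A ++ [.star, .star] ++ B ∧
    IsReading (r ++ [x]) (A ++ oneWay e :: B ++ [.star, .star])

theorem isExchange_replicate {M : ℕ} (hM : 2 ≤ M) (b e : Bool) :
    IsExchange (replicate M .star) (oneWay b) 0 e := by
  obtain ⟨N, rfl⟩ := Nat.exists_eq_add_of_le' hM
  exact ⟨[], replicate N .star, rfl, rfl, isReading_replicate N b e⟩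

theorem IsExchange.isReading {A B : Word} {e : Bool} (h : IsExchange r x A.length e)
    (hr : r = A ++ [.star, .star] ++ B) :
    IsReading (r ++ [x]) (A ++ oneWay e :: B ++ [.star, .star]) := by
  obtain ⟨A₁, B₁, hA₁, hr₁, h⟩ := h
  rw [hr, append_assoc, append_assoc] at hr₁
  obtain ⟨rfl, hB⟩ := append_inj hr₁ hA₁.symm
  obtain rfl : B = B₁ := by simpa using hB
  exact h

theorem IsExchange.exists_eq_append {A : Word} {p : ℕ} {e : Bool} (h : IsExchange r x p e)
    (hA : A <+: r) (hlt : A.length < p)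
    (hstar : ∀ y, A.length ≤ y → y ≤ p → r[y]? = some .star) :
    ∃ k B, 0 < k ∧ p = A.length + k ∧ r = A ++ replicate (k + 2) .star ++ B ∧
      IsReading (r ++ [x]) (A ++ replicate k .star ++ oneWay e :: B ++ [.star, .star]) := by
  obtain ⟨A₂, B, rfl, hr, h⟩ := h
  obtain ⟨T, rfl⟩ : A <+: A₂ :=
    prefix_of_prefix_length_le hA ⟨[.star, .star] ++ B, by simp [hr]⟩ hlt.le
  obtain ⟨k, rfl⟩ : ∃ k, T = replicate k .star := by
    refine ⟨T.length, eq_replicate_iff.2 ⟨rfl, fun c hc ↦ ?_⟩⟩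
    obtain ⟨i, hi, rfl⟩ := mem_iff_getElem.1 hc
    have := hstar (A.length + i) (by omega) (by simp; omega)
    simpa [hr, append_assoc, getElem?_append_right, getElem?_append_left hi,
      getElem?_eq_getElem hi] using this
  simp only [length_append, length_replicate] at hlt h hr ⊢
  refine ⟨k, B, by omega, rfl, ?_, h⟩
  rw [hr, replicate_add]
  simp [replicate_succ]

theorem not_isReading_of_run {A B A' B' B₂ : Word} {b e e' : Bool} {k l : ℕ} (hk : 0 < k)
    (hr : r = A ++ replicate (k + 2) .star ++ B₂) (hr' : ∀ M, r ≠ replicate M .star)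
    (hA : A <+ A') (hB : B <+ B')
    (hn : numOneWay A' + numOneWay B' ≤ numOneWay A + numOneWay B)
    (hl : replicate l .star ++ B = replicate (k + 2) .star ++ B₂) (he : k + 1 < l → e' = !e)
    (h : IsReading (r ++ [oneWay b]) (A' ++ oneWay e :: B' ++ [.star, .star]))
    (h₁ : IsReading (r ++ [oneWay b])
      (A ++ oneWay (!e) :: (replicate k .star ++ B₂) ++ [.star, .star])) :
    ¬ IsReading (r ++ [oneWay b])
      (A ++ replicate k .star ++ oneWay e' :: B₂ ++ [.star, .star]) := by
  intro h₂
  rcases eq_replicate_or_exists_last_oneWay A with ⟨i, rfl⟩ | ⟨A, a, i, rfl⟩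
  · rcases eq_replicate_or_exists_last_oneWay B₂ with ⟨u, rfl⟩ | ⟨Q, a, u, rfl⟩
    · exact hr' (i + (k + 2) + u) (by simp [hr])
    · have hQ : leadingRun Q = u := by
        refine leadingRun_eq_of_isReading (p := i + k) (a := a) (b := b) (e := e') ?_
        simpa [hr, replicate_add, -replicate_append_replicate] using h₂
      have hQ' : leadingRun (replicate k .star ++ Q) = u := by
        refine leadingRun_eq_of_isReading (p := i) (a := a) (b := b) (e := !e) ?_
        rw [hr, add_comm k] at h₁
        simpa [replicate_add] using h₁
      rw [leadingRun_replicate_append] at hQ'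
      omega
  · refine not_isReading_of_inner_run (b := b) (i := i) hk ?_ hA hB (by simpa using hn) hl he h h₁
      ?_
    · simp [hr, replicate_add, -replicate_append_replicate]
    · simpa [replicate_add, -replicate_append_replicate] using h₂

theorem exists_sign_of_not_both (h : ∀ p e, IsExchange r x p e → ¬ IsExchange r x p !e) :
    ∃ s : ℕ → Bool, (∀ p e, IsExchange r x p e → s p = e) ∧
      ∀ p, r[p]? = some .star → r[p + 1]? = some .star → s p = s (p + 1) →
        (∃ e, IsExchange r x p e) ∧ ∃ p' > p, (∃ e, IsExchange r x p' e) ∧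
          ∀ y, p ≤ y → y ≤ p' → r[y]? = some .star := by
  have huniq (p : ℕ) : ∃ c, ∀ e, IsExchange r x p e → c = e := by
    by_cases htrue : IsExchange r x p true
    · exact ⟨true, fun e he ↦ by cases e; exacts [absurd he (h p _ htrue), rfl]⟩
    · exact ⟨false, fun e he ↦ by cases e; exacts [rfl, absurd he htrue]⟩
  choose c hc using huniq
  obtain ⟨s, hs, hrun, -⟩ := exists_signs r (fun p ↦ ∃ e, IsExchange r x p e) c true <| by
    rintro p ⟨e, A, B, rfl, rfl, -⟩
    simp
  refine ⟨s, fun p e he ↦ (hs p ⟨e, he⟩).trans (hc p e he), fun p h₀ h₁ heq ↦ ?_⟩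
  refine (hrun p h₀ h₁).resolve_left fun h' ↦ ?_
  simp [heq] at h'

theorem FactorsForce.exists_isExchange_both (H : FactorsForce (r ++ [x]) r) (hr : r ≠ []) :
    ∃ b p, x = oneWay b ∧ ∀ e, IsExchange r x p e := by
  obtain ⟨b, -, -, -, -, -, -, rfl, -⟩ := H.exists_isReading hr fun _ ↦ true
  by_contra! hcon
  have hnot (p : ℕ) (e : Bool) (he : IsExchange r (oneWay b) p e) :
      ¬ IsExchange r (oneWay b) p !e := by
    intro he'
    obtain ⟨d, hd⟩ := hcon b p rfl
    rcases Bool.eq_or_eq_not d e with rfl | rfl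
    exacts [hd he, hd he']
  obtain ⟨s, hs, hrun⟩ := exists_sign_of_not_both hnot
  obtain ⟨-, A, B, L, e, A', B', -, hrAB, hL, hA, hB, hn, h, hsL⟩ := H.exists_isReading hr s
  have hs₀ : s A.length = !e := hsL 0 (by omega)
  obtain rfl | hL₃ : L = 2 ∨ 3 ≤ L := by omega
  · have hlen := h.length_eq
    simp only [hrAB, length_append, length_cons, length_nil, length_replicate] at hlen
    have hA' := hA.eq_of_length (by have := hA.length_le; have := hB.length_le; omega)
    have hB' := hB.eq_of_length (by have := hA.length_le; have := hB.length_le; omega)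
    subst hA' hB'
    simp [hs _ e ⟨A, B, rfl, hrAB, h⟩] at hs₀
  have hget (i : ℕ) (hi : i < L) : r[A.length + i]? = some .star := by
    simp [hrAB, getElem?_append_right, getElem?_append_left, hi]
  obtain ⟨⟨e₁, h₁⟩, p', hp', ⟨e', h'⟩, hstar⟩ := hrun A.length (hget 0 (by omega))
    (hget 1 (by omega)) (hs₀.trans (hsL 1 (by omega)).symm)
  obtain rfl : e₁ = !e := (hs _ _ h₁).symm.trans hs₀
  obtain ⟨k, B₂, hk, rfl, hr₂, h₂⟩ :=
    h'.exists_eq_append ⟨_, by rw [hrAB, append_assoc]⟩ hp' hstar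
  refine not_isReading_of_run (l := L) hk hr₂ ?_ hA hB hn.le ?_ ?_ h (h₁.isReading ?_) h₂
  · rintro M rfl
    obtain ⟨d, hd⟩ := hcon b 0 rfl
    have hlen := congrArg List.length hr₂
    simp only [length_append, length_replicate] at hlen
    exact hd (isExchange_replicate (by omega) b d)
  · simpa [hrAB] using hr₂
  · exact fun hkL ↦ (hs _ _ h').symm.trans (hsL k hkL)
  · simp [hr₂, replicate_succ]

theorem FactorsForce.exists_isReading_both (H : FactorsForce (r ++ [x]) r) (hr : r ≠ []) :
    ∃ A B b, x = oneWay b ∧ r = A ++ [.star, .star] ++ B ∧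
      ∀ e, IsReading (r ++ [x]) (A ++ oneWay e :: B ++ [.star, .star]) := by
  obtain ⟨b, p, rfl, h⟩ := H.exists_isExchange_both hr
  obtain ⟨A, B, rfl, hrAB, -⟩ := h true
  exact ⟨A, B, b, rfl, hrAB, fun e ↦ (h e).isReading hrAB⟩

end FactorsForce

/-! ### Lifting homomorphisms to the integers -/

section Lifts

open Relation
open scoped Fin.CommRing

variable {V : Type*} {E : V → V → Prop} {n N : ℕ} [NeZero n] {G : Digraph (Fin n)}

theorem IsPath.symmGen_iff {Q : Digraph (Fin (N + 1))} (hQ : IsPath N Q) {a b : Fin (N + 1)} :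
    SymmGen Q.Adj a b ↔ (a : ℕ) ≤ b + 1 ∧ (b : ℕ) ≤ a + 1 := by
  obtain rfl | h := eq_or_ne a b
  · simp [SymmGen, hQ.refl]
  · exact (hQ.adj_iff a b h).trans (by omega)

theorem succ_mod_eq_iff {i j : Fin n} : ((i : ℕ) + 1) % n = j ↔ j = i + 1 := by
  rw [eq_comm, Fin.ext_iff, Fin.val_add, Fin.val_one', Nat.add_mod_mod]

theorem IsCycle.symmGen_iff (hG : IsCycle n G) {u v : Fin n} :
    SymmGen G.Adj u v ↔ v = u ∨ v = u + 1 ∨ v = u - 1 := by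
  obtain rfl | h := eq_or_ne u v
  · simp [SymmGen, hG.refl]
  · rw [SymmGen, hG.adj_iff u v h, succ_mod_eq_iff, succ_mod_eq_iff,
      eq_sub_iff_add_eq, eq_comm (a := u)]
    simp [h.symm]

/-- A step of the relation `E` from `u` to `v`, along an arc if `y` is `true` and against an arc if
`y` is `false`. -/
def Step (E : V → V → Prop) (y : Bool) (u v : V) : Prop := if y then E u v else E v u

theorem Step.refl (hE : ∀ v, E v v) (y : Bool) (v : V) : Step E y v v := by
  cases y <;> exact hE v

theorem Step.map {V' : Type*} {E' : V' → V' → Prop} {g : V → V'}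
    (hg : ∀ u v, E u v → E' (g u) (g v)) {y : Bool} {u v : V} (h : Step E y u v) :
    Step E' y (g u) (g v) := by
  cases y <;> exact hg _ _ h

theorem Step.symmGen {y : Bool} {u v : V} (h : Step E y u v) : SymmGen E u v := by
  cases y
  exacts [.inr h, .inl h]

/-- `F` is a lift of `g` to the universal cover of a cycle: it is integer-valued, congruent to `g`,
and changes by at most one along each arc of `E`. -/
structure IsLift (E : V → V → Prop) (g : V → Fin n) (F : V → ℤ) : Prop where
  cast_eq : ∀ v, (F v : Fin n) = g v
  abs_sub_le : ∀ {u v}, SymmGen E u v → |F v - F u| ≤ 1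

theorem IsCycle.abs_sub_le (hG : IsCycle n G) (hn : 4 ≤ n) {z z' : ℤ}
    (h : SymmGen G.Adj (z : Fin n) z') (h₂ : |z' - z| ≤ 2) : |z' - z| ≤ 1 := by
  have hsmall {d : ℤ} (hd : ((z' - z - d : ℤ) : Fin n) = 0) (hd₁ : |d| ≤ 1) : |z' - z| ≤ 1 := by
    rw [CharP.intCast_eq_zero_iff (Fin n) n] at hd
    have := Int.eq_zero_of_abs_lt_dvd hd (by grind)
    grind
  rcases hG.symmGen_iff.1 h with h | h | h
  exacts [hsmall (d := 0) (by simp [h]) (by simp), hsmall (d := 1) (by simp [h]) (by simp),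
    hsmall (d := -1) (by simp [h]) (by simp)]

theorem IsCycle.exists_cast_eq (hG : IsCycle n G) {z : ℤ} {v : Fin n}
    (h : SymmGen G.Adj (z : Fin n) v) : ∃ z' : ℤ, (z' : Fin n) = v ∧ |z' - z| ≤ 1 := by
  rcases hG.symmGen_iff.1 h with rfl | rfl | rfl
  exacts [⟨z, rfl, by simp⟩, ⟨z + 1, by simp, by simp⟩, ⟨z - 1, by simp, by simp⟩]

theorem IsLift.exists_of_homotopic (hG : IsCycle n G) (hn : 4 ≤ n) (hE : ∀ v, E v v)
    {g g' : V → Fin n} {y : Bool} (hg : ∀ u v, E u v → G.Adj (g u) (g v))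
    (h : ∀ u v, Step E y u v → SymmGen G.Adj (g' u) (g v)) {F' : V → ℤ} (hF' : IsLift E g' F') :
    ∃ F, IsLift E g F := by
  have hnear (v : V) : ∃ z : ℤ, (z : Fin n) = g v ∧ |z - F' v| ≤ 1 :=
    hG.exists_cast_eq (by rw [hF'.cast_eq]; exact h v v (.refl hE y v))
  choose F hF hFF' using hnear
  have hstep {u v : V} (huv : Step E y u v) : |F v - F u| ≤ 1 := by
    have h₁ := hF'.abs_sub_le huv.symmGen
    have h₂ := hFF' u
    have h₃ := hFF' v
    have h₄ : |F v - F' u| ≤ 1 :=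
      hG.abs_sub_le hn (by rw [hF, hF'.cast_eq]; exact h u v huv) (by grind)
    exact hG.abs_sub_le hn (by rw [hF, hF]; exact (huv.map hg).symmGen) (by grind)
  refine ⟨F, hF, fun {u v} huv ↦ ?_⟩
  have huv' : Step E y u v ∨ Step E y v u := by
    cases y
    exacts [huv.symm, huv]
  exact huv'.elim hstep fun h ↦ abs_sub_comm (F v) (F u) ▸ hstep h

theorem IsPath.step_inf {Q : Digraph (Fin (N + 1))} (hQ : IsPath N Q) {y : Bool}
    {l l' a b : Fin (N + 1)} (hl : l ≤ l') (h₀ : Step Q.Adj y l l') (h : Step Q.Adj y a b) :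
    Step Q.Adj y (a ⊓ l) (b ⊓ l') := by
  have hll := hQ.symmGen_iff.1 h₀.symmGen
  have hab := hQ.symmGen_iff.1 h.symmGen
  rcases lt_or_ge l b with hb | hb
  · rwa [inf_of_le_right (show l ≤ a by omega), inf_of_le_right (show l' ≤ b by omega)]
  · rw [inf_of_le_left (hb.trans hl)]
    rcases le_or_gt a l with ha | ha
    · rwa [inf_of_le_left ha]
    · obtain rfl : b = l := by omega
      rw [inf_of_le_right ha.le]
      exact .refl hQ.refl y b

section Product

variable {ι : Type*} {Q : ι → Digraph (Fin (N + 1))} {f : (ι → Fin (N + 1)) → Fin n}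

theorem exists_isLift_inf_of_step (hG : IsCycle n G) (hn : 4 ≤ n) (hQ : ∀ i, IsPath N (Q i))
    (hf : ∀ u v, (prodDigraph Q).Adj u v → G.Adj (f u) (f v)) {L L' : ι → Fin (N + 1)} {y : Bool}
    (hL : L ≤ L') (h : ∀ i, Step (Q i).Adj y (L i) (L' i))
    (hlift : ∃ F, IsLift (prodDigraph Q).Adj (fun x ↦ f (x ⊓ L)) F) :
    ∃ F, IsLift (prodDigraph Q).Adj (fun x ↦ f (x ⊓ L')) F := by
  obtain ⟨F, hF⟩ := hlift
  refine hF.exists_of_homotopic hG hn (fun v i ↦ (hQ i).refl _) (y := y)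
    (fun u v huv ↦ hf _ _ fun i ↦ ?_) fun u v huv ↦ (Step.map hf (y := y) ?_).symmGen
  · exact (hQ i).step_inf (y := true) le_rfl ((hQ i).refl _) (huv i)
  · cases y
    exacts [fun i ↦ (hQ i).step_inf (y := false) (hL i) (h i) (huv i),
      fun i ↦ (hQ i).step_inf (y := true) (hL i) (h i) (huv i)]

/-- Raising all the levels by one is done in two homotopies: first in those coordinates where it
follows an arc, then in the others. -/
theorem exists_isLift_inf_clamp (hG : IsCycle n G) (hn : 4 ≤ n) (hQ : ∀ i, IsPath N (Q i))
    (hf : ∀ u v, (prodDigraph Q).Adj u v → G.Adj (f u) (f v)) (l : ℕ) :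
    ∃ F, IsLift (prodDigraph Q).Adj (fun x ↦ f (x ⊓ fun _ ↦ Fin.clamp l N)) F := by
  classical
  induction l with
  | zero =>
    have h₀ (x : ι → Fin (N + 1)) : (x ⊓ fun _ ↦ Fin.clamp 0 N) = 0 := by
      ext i; simp
    exact ⟨fun _ ↦ (f 0 : ℕ), fun x ↦ by simp [h₀], by simp⟩
  | succ l ih =>
    let M (i : ι) := if (Q i).Adj (Fin.clamp l N) (Fin.clamp (l + 1) N) then Fin.clamp (l + 1) N
      else Fin.clamp l N
    have hle : Fin.clamp l N ≤ Fin.clamp (l + 1) N := Fin.clamp_monotone l.le_succ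
    have hM : ∃ F, IsLift (prodDigraph Q).Adj (fun x ↦ f (x ⊓ M)) F := by
      refine exists_isLift_inf_of_step hG hn hQ hf (y := true) (fun i ↦ ?_) (fun i ↦ ?_) ih
      · dsimp only [M]; split_ifs
        exacts [hle, le_rfl]
      · dsimp only [M]; split_ifs with h
        exacts [h, (hQ i).refl _]
    refine exists_isLift_inf_of_step hG hn hQ hf (y := false) (fun i ↦ ?_) (fun i ↦ ?_) hM
    · dsimp only [M]; split_ifs
      exacts [le_rfl, hle]
    · dsimp only [M]; split_ifs with h
      · exact (hQ i).refl _
      · exact ((hQ i).symmGen_iff.2 (by simp; omega)).resolve_left h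

theorem exists_isLift_of_prod_paths (hG : IsCycle n G) (hn : 4 ≤ n) (hQ : ∀ i, IsPath N (Q i))
    (hf : ∀ u v, (prodDigraph Q).Adj u v → G.Adj (f u) (f v)) :
    ∃ F, IsLift (prodDigraph Q).Adj f F := by
  have htop (x : ι → Fin (N + 1)) : (x ⊓ fun _ ↦ Fin.clamp N N) = x :=
    inf_of_le_left fun i ↦ by rw [Fin.clamp_eq_last N N le_rfl]; exact Fin.le_last _
  simpa only [htop] using exists_isLift_inf_clamp hG hn hQ hf N

end Product

theorem IsLift.exists_add_le [Finite V] {g : V → Fin n} {F : V → ℤ} (hF : IsLift E g F)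
    (hg : Function.Surjective g) : ∃ u v, F u + (n - 1 : ℕ) ≤ F v := by
  have : Nonempty V := hg.nonempty
  obtain ⟨u, hu⟩ := Finite.exists_min F
  obtain ⟨v, hv⟩ := hg (F u + (n - 1 : ℕ) : ℤ)
  refine ⟨u, v, ?_⟩
  rw [← hF.cast_eq, CharP.intCast_eq_intCast (Fin n) n, Int.modEq_iff_dvd] at hv
  by_contra! hlt
  have := Int.eq_zero_of_abs_lt_dvd hv (by grind [NeZero.pos n])
  omega

end Lifts

/-! ### Words read along a cycle -/

section Words

open Relation

variable {V : Type*} {G : Digraph V}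

open Classical in
/-- The letter describing the arcs between two linked vertices, read from `u` to `v`. -/
noncomputable def between (G : Digraph V) (u v : V) : Letter :=
  if G.Adj u v then if G.Adj v u then .star else .plus else .minus

theorem between_allows_iff {u v : V} (h : SymmGen G.Adj u v) {y : Bool} :
    (between G u v).Allows y ↔ Step G.Adj y u v := by
  unfold between
  cases y <;> split_ifs <;> simp_all [SymmGen, Step, Letter.Allows, Letter.oneWay]

theorem between_comm {u v : V} (h : SymmGen G.Adj u v) :
    between G v u = (between G u v).flip := by
  unfold between
  split_ifs <;> simp_all [SymmGen, Letter.flip]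

/-- The word read along the first `k` steps of a sequence of vertices. -/
noncomputable def wordAlong (G : Digraph V) (v : ℕ → V) (k : ℕ) : Word :=
  (range k).map fun i ↦ between G (v i) (v (i + 1))

@[simp] theorem length_wordAlong (v : ℕ → V) (k : ℕ) : (wordAlong G v k).length = k := by
  simp [wordAlong]

theorem wordAlong_add (v : ℕ → V) (k l : ℕ) :
    wordAlong G v (k + l) = wordAlong G v k ++ wordAlong G (fun i ↦ v (k + i)) l := by
  simp [wordAlong, range_add, Function.comp_def, add_assoc]

theorem wordAlong_succ (v : ℕ → V) (k : ℕ) :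
    wordAlong G v (k + 1) = between G (v 0) (v 1) :: wordAlong G (fun i ↦ v (i + 1)) k := by
  simp [wordAlong, range_succ_eq_map, Function.comp_def]

theorem opposite_wordAlong {v : ℕ → V} {k : ℕ} (hv : ∀ i < k, SymmGen G.Adj (v i) (v (i + 1))) :
    opposite (wordAlong G v k) = wordAlong G (fun i ↦ v (k - i)) k := by
  induction k with
  | zero => rfl
  | succ k ih =>
    rw [wordAlong_add, opposite_append, ih fun i hi ↦ hv i (by omega), wordAlong_succ]
    simp [wordAlong, range_succ_eq_map, Function.comp_def, between_comm (hv k (by omega))]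

end Words

section ArcWords

open Relation
open scoped Fin.CommRing

variable {n : ℕ} [NeZero n] {G : Digraph (Fin n)} {ε : Fin n}

/-- The word of length `k` read along the cycle `G`, from the vertex `b` in the direction
`ε = ±1`. -/
noncomputable def arcWord (G : Digraph (Fin n)) (ε b : Fin n) (k : ℕ) : Word :=
  wordAlong G (fun i ↦ b + ε * i) k

@[simp] theorem length_arcWord (ε b : Fin n) (k : ℕ) : (arcWord G ε b k).length = k :=
  length_wordAlong _ _

theorem arcWord_add (ε b : Fin n) (k l : ℕ) :
    arcWord G ε b (k + l) = arcWord G ε b k ++ arcWord G ε (b + ε * k) l := by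
  simp [arcWord, wordAlong_add, mul_add, add_assoc]

theorem arcWord_succ (ε b : Fin n) (k : ℕ) :
    arcWord G ε b (k + 1) = between G b (b + ε) :: arcWord G ε (b + ε) k := by
  simp [arcWord, wordAlong_succ, mul_add, add_assoc, add_comm ε]

theorem arcWord_eq_append_singleton (G : Digraph (Fin n)) (ε b : Fin n) :
    ∃ x, arcWord G ε b n = arcWord G ε b (n - 1) ++ [x] := by
  have hsplit := arcWord_add (G := G) ε b (n - 1) 1
  rw [Nat.sub_add_cancel (Nat.pos_of_neZero n)] at hsplit
  exact ⟨_, hsplit⟩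

theorem arcWord_rotate (ε b : Fin n) (k : ℕ) :
    (arcWord G ε b n).rotate k = arcWord G ε (b + ε * k) n := by
  refine ext_getElem (by simp) fun i _ _ ↦ ?_
  simp only [getElem_rotate, arcWord, wordAlong, getElem_map, getElem_range, length_map,
    length_range, Nat.cast_succ, ← CharP.cast_eq_mod (Fin n) n, Nat.cast_add]
  ring_nf

theorem IsCycle.symmGen_add (hG : IsCycle n G) (hε : ε = 1 ∨ ε = -1) (u : Fin n) :
    SymmGen G.Adj u (u + ε) :=
  hG.symmGen_iff.2 (by rcases hε with rfl | rfl <;> simp [sub_eq_add_neg])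

theorem IsCycle.symmGen_add_mul (hG : IsCycle n G) (hε : ε = 1 ∨ ε = -1) (b : Fin n) (i : ℕ) :
    SymmGen G.Adj (b + ε * i) (b + ε * (i + 1 : ℕ)) := by
  convert hG.symmGen_add hε (b + ε * i) using 1
  push_cast
  ring

theorem IsCycle.opposite_arcWord (hG : IsCycle n G) (b : Fin n) :
    opposite (arcWord G 1 b n) = arcWord G (-1) b n := by
  rw [arcWord, opposite_wordAlong fun i _ ↦ hG.symmGen_add_mul (.inl rfl) b i, arcWord]
  refine map_congr_left fun i hi ↦ ?_
  have hi := mem_range.1 hi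
  congr 1 <;> simp [Nat.cast_sub hi.le, Nat.cast_sub (show i + 1 ≤ n from hi)]

theorem arcWord_isRotated_iff (hε : ε = 1 ∨ ε = -1) {b : Fin n} {q : Word} :
    arcWord G ε b n ~r q ↔ ∃ b', q = arcWord G ε b' n := by
  constructor
  · rintro ⟨k, rfl⟩
    exact ⟨_, arcWord_rotate ε b k⟩
  · rintro ⟨b', rfl⟩
    refine ⟨(ε * (b' - b) : Fin n), ?_⟩
    rw [arcWord_rotate]
    congr 1
    rcases hε with rfl | rfl <;> simp

theorem IsCycle.isReading_iff (hG : IsCycle n G) {b : Fin n} {q : Word} :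
    IsReading (arcWord G 1 b n) q ↔ ∃ ε b', (ε = 1 ∨ ε = -1) ∧ q = arcWord G ε b' n := by
  simp only [IsReading, Bool.exists_bool, reading, if_true, Bool.false_eq_true, if_false,
    hG.opposite_arcWord, isRotated_comm (l := q), arcWord_isRotated_iff (.inl rfl),
    arcWord_isRotated_iff (.inr rfl), or_and_right, exists_or, exists_and_left, exists_eq_left]
  exact or_comm

theorem IsCycle.isCycleOf_arcWord (hG : IsCycle n G) (hε : ε = 1 ∨ ε = -1) (b : Fin n) :
    IsCycleOf G (arcWord G ε b n) := by
  have hget : ∀ i (hi : i < (arcWord G ε b n).length),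
      (arcWord G ε b n)[i] = between G (b + ε * i) (b + ε * (i + 1)) := by
    simp [arcWord, wordAlong]
  have hlen := length_arcWord (G := G) ε b n
  generalize arcWord G ε b n = W at hget hlen
  subst hlen
  let φ : Fin W.length ≃ Fin W.length :=
    ⟨fun i ↦ b + ε * i, fun j ↦ ε * (j - b), fun i ↦ by rcases hε with rfl | rfl <;> simp,
      fun j ↦ by rcases hε with rfl | rfl <;> simp⟩
  have hadj (i : Fin W.length) : SymmGen G.Adj (φ i) (φ (i + 1)) := by
    convert hG.symmGen_add hε (φ i) using 1
    simp only [φ, Equiv.coe_fn_mk]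
    ring
  have hallows (i : Fin W.length) (y : Bool) :
      W.get i = Letter.oneWay y ∨ W.get i = .star ↔ Step G.Adj y (φ i) (φ (i + 1)) := by
    rw [← between_allows_iff (hadj i), or_comm, get_eq_getElem, hget, Fin.cast_val_eq_self]
    rfl
  refine ⟨RelIso.symm ⟨φ, fun {i j} ↦ ?_⟩⟩
  have hnext (h : G.Adj (φ i) (φ j)) : i = j ∨ j = i + 1 ∨ i = j + 1 := by
    rcases hG.symmGen_iff.1 (.inl h) with h | h | h
    · exact .inl (φ.injective h.symm)
    all_goals
      simp only [φ, Equiv.coe_fn_mk] at h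
      grind
  simp only [cycleOfWord, succ_mod_eq_iff]
  constructor
  · intro h
    rcases hnext h with rfl | rfl | rfl
    exacts [.inl rfl, .inr (.inl ⟨rfl, (hallows i true).2 h⟩),
      .inr (.inr ⟨rfl, (hallows j false).2 h⟩)]
  · rintro (rfl | ⟨rfl, h⟩ | ⟨rfl, h⟩)
    exacts [hG.refl _, (hallows i true).1 h, (hallows j false).1 h]

end ArcWords

section Walks

open Relation

variable {V : Type*} {E : V → V → Prop}

/-- There is a walk from `u` to `v` whose steps have the directions listed in `w`. -/
def HasWalk (E : V → V → Prop) : List Bool → V → V → Prop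
  | [], u, v => u = v
  | y :: w, u, v => ∃ u', Step E y u u' ∧ HasWalk E w u' v

theorem HasWalk.refl (hE : ∀ v, E v v) (v : V) : ∀ w, HasWalk E w v v
  | [] => rfl
  | y :: w => ⟨v, .refl hE y v, refl hE v w⟩

theorem hasWalk_prodDigraph {ι : Type*} {V : ι → Type*} {Q : (i : ι) → Digraph (V i)} :
    ∀ {w : List Bool} {x y : (i : ι) → V i}, (∀ i, HasWalk (Q i).Adj w (x i) (y i)) →
      HasWalk (prodDigraph Q).Adj w x y
  | [], _, _, h => funext h
  | y :: w, _, _, h => by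
    choose u hu hw using h
    refine ⟨u, ?_, hasWalk_prodDigraph hw⟩
    cases y
    exacts [fun i ↦ hu i, fun i ↦ hu i]

theorem hasWalk_of_embeds {G : Digraph V} (hrefl : ∀ v, G.Adj v v) :
    ∀ {w : List Bool} {k : ℕ} {v : ℕ → V}, (∀ i < k, SymmGen G.Adj (v i) (v (i + 1))) →
      Embeds (wordAlong G v k) w → HasWalk G.Adj w (v 0) (v k)
  | w, 0, v, _, _ => .refl hrefl _ w
  | [], k + 1, v, _, h => by
    rw [wordAlong_succ] at h
    exact nomatch h
  | y :: w, k + 1, v, hv, h => by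
    by_cases hy : (between G (v 0) (v 1)).Allows y
    · rw [wordAlong_succ, embeds_cons_iff_of_allows hy] at h
      exact ⟨v 1, (between_allows_iff (hv 0 (by omega))).1 hy,
        hasWalk_of_embeds hrefl (fun i hi ↦ hv (i + 1) (by omega)) h⟩
    · rw [wordAlong_succ, embeds_cons_iff_of_not_allows hy, ← wordAlong_succ] at h
      exact ⟨v 0, .refl hrefl y _, hasWalk_of_embeds hrefl hv h⟩

open scoped Fin.CommRing in
/-- The lift of the walk passes through `a, a + 1, …, a + k`, and it can leave a place for the next
one only by a step which the corresponding letter allows. -/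
theorem IsLift.embeds_arcWord {n : ℕ} [NeZero n] {G : Digraph (Fin n)} (hG : IsCycle n G)
    {g : V → Fin n} (hg : ∀ u v, E u v → G.Adj (g u) (g v)) {F : V → ℤ} (hF : IsLift E g F) :
    ∀ {w : List Bool} {k : ℕ} {a : ℤ} {u v : V}, HasWalk E w u v → F u ≤ a → a + k ≤ F v →
      Embeds (arcWord G 1 a k) w
  | _, 0, _, _, _, _, _, _ => .nil
  | [], k + 1, a, u, v, h, h₁, h₂ => by
    obtain rfl : u = v := h
    omega
  | y :: w, k + 1, a, u, v, ⟨u', hstep, hw⟩, h₁, h₂ => by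
    have hF₁ := hF.abs_sub_le hstep.symmGen
    have ha : ((a + 1 : ℤ) : Fin n) = a + 1 := by push_cast; rfl
    by_cases hy : (between G a (a + 1 : Fin n)).Allows y
    · rw [arcWord_succ, embeds_cons_iff_of_allows hy, ← ha]
      exact embeds_arcWord hG hg hF hw (by grind) (by grind)
    · have hu' : F u' ≤ a := by
        by_contra! hlt
        obtain rfl : F u = a := by grind
        have hFu' : (F u' : Fin n) = F u + 1 := by rw [← ha]; congr 1; grind
        refine hy ((between_allows_iff (hG.symmGen_add (.inl rfl) _)).2 ?_)
        rw [← hFu', hF.cast_eq, hF.cast_eq]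
        exact hstep.map hg
      rw [arcWord_succ, embeds_cons_iff_of_not_allows hy, ← arcWord_succ]
      exact embeds_arcWord hG hg hF hw hu' h₂

end Walks

section PathsInCycle

open Relation

theorem exists_eq_add_mul {R : Type*} [CommRing R] {N : ℕ} {v : ℕ → R}
    (h₁ : ∀ p < N, v (p + 1) = v p + 1 ∨ v (p + 1) = v p - 1)
    (h₂ : ∀ p, p + 1 < N → v (p + 2) ≠ v p) :
    ∃ ε : R, (ε = 1 ∨ ε = -1) ∧ ∀ p ≤ N, v p = v 0 + ε * p := by
  induction N with
  | zero => exact ⟨1, .inl rfl, by simp⟩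
  | succ N ih =>
    obtain ⟨ε, hε, hv⟩ := ih (fun p hp ↦ h₁ p (by omega)) fun p hp ↦ h₂ p (by omega)
    obtain _ | N := N
    · rcases h₁ 0 one_pos with h | h
      · exact ⟨1, .inl rfl, fun p hp ↦ by interval_cases p <;> simp [h]⟩
      · exact ⟨-1, .inr rfl, fun p hp ↦ by interval_cases p <;> simp [h, sub_eq_add_neg]⟩
    · refine ⟨ε, hε, fun p hp ↦ ?_⟩
      obtain hp | rfl := hp.lt_or_eq
      · exact hv p (by omega)
      have hN := h₁ (N + 1) (by omega)
      have hne := h₂ N (by omega)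
      have e₁ := hv N (by omega)
      have e₂ := hv (N + 1) le_rfl
      push_cast at e₂ ⊢
      rcases hε with rfl | rfl <;> grind

theorem wordAlong_comp {V V' : Type*} {G : Digraph V} {G' : Digraph V'} (φ : G'.Adj ↪r G.Adj)
    (v : ℕ → V') (k : ℕ) :
    wordAlong G (φ ∘ v) k = wordAlong G' v k := by
  refine map_congr_left fun i _ ↦ ?_
  unfold between
  congr 1
  · exact propext φ.map_rel_iff
  · congr 1
    exact propext φ.map_rel_iff

open scoped Fin.CommRing

variable {n N : ℕ} [NeZero n] {G : Digraph (Fin n)} {Q : Digraph (Fin (N + 1))}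

theorem IsPath.exists_direction (hQ : IsPath N Q) (hG : IsCycle n G) (φ : Q.Adj ↪r G.Adj) :
    ∃ ε b : Fin n, (ε = 1 ∨ ε = -1) ∧ ∀ i : Fin (N + 1), φ i = b + ε * (i : ℕ) := by
  have hne {p q : ℕ} (hp : p ≤ N) (hq : q ≤ N) (hpq : p ≠ q) :
      φ (Fin.clamp p N) ≠ φ (Fin.clamp q N) := fun h ↦ by
    have := congrArg Fin.val (φ.injective h)
    simp only [Fin.coe_clamp] at this
    omega
  have hstep (p : ℕ) (hp : p < N) : φ (Fin.clamp (p + 1) N) = φ (Fin.clamp p N) + 1 ∨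
      φ (Fin.clamp (p + 1) N) = φ (Fin.clamp p N) - 1 := by
    have hQp : SymmGen Q.Adj (Fin.clamp p N) (Fin.clamp (p + 1) N) :=
      hQ.symmGen_iff.2 (by simp; omega)
    have hGp : SymmGen G.Adj (φ (Fin.clamp p N)) (φ (Fin.clamp (p + 1) N)) := by
      simpa only [SymmGen, φ.map_rel_iff] using hQp
    exact (hG.symmGen_iff.1 hGp).resolve_left (hne hp hp.le (by omega))
  obtain ⟨ε, hε, hv⟩ := exists_eq_add_mul (v := fun p ↦ φ (Fin.clamp p N)) hstep
    fun p hp ↦ hne (by omega) (by omega) (by omega)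
  refine ⟨ε, φ (Fin.clamp 0 N), hε, fun i ↦ ?_⟩
  rw [← hv i (Nat.lt_succ_iff.1 i.2)]
  exact congrArg φ (Fin.ext (by simp; omega))

theorem IsPath.exists_arc (hQ : IsPath N Q) (hG : IsCycle n G) (φ : Q.Adj ↪r G.Adj)
    (x y : Fin (N + 1)) : ∃ (ε b : Fin n) (l : ℕ) (v : ℕ → Fin (N + 1)), (ε = 1 ∨ ε = -1) ∧
      l ≤ N ∧ v 0 = x ∧ v l = y ∧ ∀ i ≤ l, φ (v i) = b + ε * i := by
  obtain ⟨ε, b, hε, hφ⟩ := hQ.exists_direction hG φ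
  rcases le_total x y with hxy | hxy
  · refine ⟨ε, b + ε * (x : ℕ), y - x, fun i ↦ Fin.clamp (x + i) N, hε, by omega,
      Fin.ext (by simp; omega), Fin.ext (by simp; omega), fun i hi ↦ ?_⟩
    rw [hφ, Fin.coe_clamp, min_eq_left (by omega)]
    push_cast
    ring
  · refine ⟨-ε, b + ε * (x : ℕ), x - y, fun i ↦ Fin.clamp (x - i) N, ?_, by omega,
      Fin.ext (by simp; omega), Fin.ext (by simp; omega), fun i hi ↦ ?_⟩
    · rcases hε with rfl | rfl <;> simp
    · rw [hφ, Fin.coe_clamp, min_eq_left (by omega), Nat.cast_sub (by omega)]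
      ring

theorem IsPath.hasWalk (hQ : IsPath N Q) (hG : IsCycle n G) (φ : Q.Adj ↪r G.Adj) {w : List Bool}
    (hw : ∀ ε b, ε = 1 ∨ ε = -1 → Embeds (arcWord G ε b N) w) (x y : Fin (N + 1)) :
    HasWalk Q.Adj w x y := by
  obtain ⟨ε, b, l, v, hε, hl, rfl, rfl, hv⟩ := hQ.exists_arc hG φ x y
  refine hasWalk_of_embeds hQ.refl (fun i hi ↦ ?_) ?_
  · have := hG.symmGen_add_mul hε b i
    rw [← hv i hi.le, ← hv (i + 1) hi] at this
    simpa only [SymmGen, φ.map_rel_iff] using this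
  · have hword : wordAlong Q v l = arcWord G ε b l := by
      rw [← wordAlong_comp φ]
      refine map_congr_left fun i hi ↦ ?_
      have hi := mem_range.1 hi
      rw [Function.comp_apply, Function.comp_apply, hv i hi.le, hv (i + 1) hi]
    obtain ⟨k, rfl⟩ := Nat.exists_eq_add_of_le hl
    have := hw ε b hε
    rw [arcWord_add] at this
    rw [hword]
    exact Embeds.of_append this

end PathsInCycle

section Conclusion

theorem IsReading.of_isRotated {W p q : Word} (h : IsReading W q) (hpq : p ~r q) :
    IsReading W p := h.imp fun _ ↦ hpq.trans

theorem IsReading.opposite {W q : Word} (h : IsReading W q) : IsReading W (opposite q) := by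
  obtain ⟨τ, h⟩ := h
  refine ⟨!τ, ?_⟩
  cases τ <;> simpa [reading] using opposite_isRotated h

theorem FactorsForce.exists_words {r : Word} {x : Letter} (H : FactorsForce (r ++ [x]) r)
    (hr : r ≠ []) : ∃ A B : Word, IsReading (r ++ [x]) (A ++ [.star, .star] ++ B ++ [.plus]) ∧
      IsReading (r ++ [x]) (A ++ [.plus] ++ B ++ [.star, .star]) ∧
      IsReading (r ++ [x]) (A ++ [.minus] ++ B ++ [.star, .star]) := by
  obtain ⟨A, B, b, hx, hrAB, h⟩ := H.exists_isReading_both hr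
  have h₀ : IsReading (r ++ [x]) (A ++ [.star, .star] ++ B ++ [oneWay b]) := by
    rw [hx, hrAB]
    exact ⟨true, .refl _⟩
  -- If `r` is followed by `-`, read the word backwards.
  cases b
  · refine ⟨opposite B, opposite A, h₀.opposite.of_isRotated ?_,
      (h false).opposite.of_isRotated ?_, (h true).opposite.of_isRotated ?_⟩
    · exact isRotated_of_eq_append (opposite B ++ [.star, .star] ++ opposite A) [.plus] rfl
        (by simp [Letter.flip, oneWay])
    · exact isRotated_of_eq_append (opposite B ++ [.plus] ++ opposite A) [.star, .star] rfl
        (by simp [Letter.flip, oneWay])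
    · exact isRotated_of_eq_append (opposite B ++ [.minus] ++ opposite A) [.star, .star] rfl
        (by simp [Letter.flip, oneWay])
  · exact ⟨A, B, h₀, by simpa [oneWay] using h true, by simpa [oneWay] using h false⟩

open scoped Fin.CommRing

variable {n : ℕ} [NeZero n] {G : Digraph (Fin n)}

theorem IsCycle.isCycleOf_of_isReading (hG : IsCycle n G) {b : Fin n} {q : Word}
    (hq : IsReading (arcWord G 1 b n) q) : IsCycleOf G q := by
  obtain ⟨ε, b', hε, rfl⟩ := hG.isReading_iff.1 hq
  exact hG.isCycleOf_arcWord hε b'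

theorem IsCycle.exists_factorsForce (hG : IsCycle n G) (hn : 4 ≤ n) (hfail : ¬ PathCondition n G) :
    ∃ a, FactorsForce (arcWord G 1 a n) (arcWord G 1 a (n - 1)) := by
  obtain ⟨m, Q, hQ, hφ, f, hf⟩ := not_not.1 hfail
  have hmap : ∀ u v, (prodDigraph Q).Adj u v → G.Adj (f u) (f v) := fun _ _ ↦ f.map_rel
  obtain ⟨F, hF⟩ := exists_isLift_of_prod_paths hG hn hQ hmap
  obtain ⟨u, v, huv⟩ := hF.exists_add_le hf
  refine ⟨F u, fun w hw ↦ hF.embeds_arcWord hG hmap (hasWalk_prodDigraph fun i ↦ ?_) le_rfl huv⟩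
  refine (hQ i).hasWalk hG (hφ i).some (fun ε b hε ↦ ?_) (u i) (v i)
  have hsplit := arcWord_add (G := G) ε b (n - 2) 2
  rw [Nat.sub_add_cancel (by omega)] at hsplit
  exact hw _ _ _ (hG.isReading_iff.2 ⟨ε, b, hε, hsplit.symm⟩)

end Conclusion

end ReflexiveCycles

theorem theorem4p6 (n : ℕ) (hn : 4 ≤ n) (G : Digraph (Fin n))
    (hG : ReflexiveCycles.IsCycle n G) (hfail : ¬ ReflexiveCycles.PathCondition n G) :
    ∃ A B : ReflexiveCycles.Word,
      ReflexiveCycles.IsCycleOf G (A ++ [.star, .star] ++ B ++ [.plus]) ∧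
      ReflexiveCycles.IsCycleOf G (A ++ [.plus] ++ B ++ [.star, .star]) ∧
      ReflexiveCycles.IsCycleOf G (A ++ [.minus] ++ B ++ [.star, .star]) := by
  have : NeZero n := ⟨by omega⟩
  obtain ⟨a, hforce⟩ := hG.exists_factorsForce hn hfail
  obtain ⟨x, hx⟩ := ReflexiveCycles.arcWord_eq_append_singleton G 1 a
  have hne : ReflexiveCycles.arcWord G 1 a (n - 1) ≠ [] :=
    List.ne_nil_of_length_pos (by rw [ReflexiveCycles.length_arcWord]; omega)
  obtain ⟨A, B, h₁, h₂, h₃⟩ := (hx ▸ hforce).exists_words hne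
  rw [← hx] at h₁ h₂ h₃
  exact ⟨A, B, hG.isCycleOf_of_isReading h₁, hG.isCycleOf_of_isReading h₂,
    hG.isCycleOf_of_isReading h₃⟩
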